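/- **Setting.** An instance of the submodular matroid secretary problem (SMSP) consists of a finite ground set $E$, a matroid $\mathcal M=(E,\mathcal I)$ and a non-negative submodular function $f\colon 2^E\to\mathbb R_{\ge 0}$, that is, $f(A\cup\{e\})-f(A)\ge f(B\cup\{e\})-f(B)$ for all $A\subseteq B\subseteq E$ and $e\in E\setminus B$; $f$ need not be monotone. The matroid secretary problem (MSP) is the special case $f(S)=\sum_{u\in S}w(u)$ with weights $w\colon E\to\mathbb R_{\ge 0}$. A (randomized, online) algorithm knows $n=|E|$ in advance. The elements of $E$ arrive one by one in a uniformly random order, independent of the internal randomness of the algorithm, and each element must be irrevocably accepted or rejected upon arrival. At each moment the algorithm can access only the value oracle ($S\mapsto f(S)$) and the independence oracle (is $S\in\mathcal I$?) on sets $S$ of elements that have already arrived, and the visible identity of these elements, given by a fixed labelling $\ell\colon E\to\Lambda$ of the ground set by elements of an arbitrary set $\Lambda$ ($\ell$ constant: anonymous elements; $\ell$ injective: fully identified elements). The set of accepted elements must always be independent: an MSP algorithm must guarantee this on all instances of MSP, an SMSP algorithm on all instances of SMSP. For $c\ge 1$, an MSP (respectively SMSP) algorithm has competitive ratio at most $c$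 (is $c$-competitive) on the labelled matroid $\mathcal M$ if for every non-negative linear (respectively non-negative submodular) $f$ on $E$ the expected value $\mathbb E[f(\mathrm{ALG})]$ of the accepted set is at least $\frac1c\max_{S\in\mathcal I}f(S)$. **Theorem.** For every MSP algorithm $\mathsf{Linear}$ and every real $\alpha\ge 1$ there exists an SMSP algorithm $\mathsf A$ with the following property: for every matroid $\mathcal M$ on which $\mathsf{Linear}$ is $\alpha$-competitive for MSP, $\mathsf A$ is $24\alpha(3\alpha+1)$-competitive for SMSP on $\mathcal M$. Moreover, $24\alpha(3\alpha+1)=O(\alpha^2)$ for $\alpha\ge 1$. -/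

import Mathlib

open MeasureTheory Asymptotics Filter

universe u v w

/-- An instance of a secretary problem on `n` elements, listed in their order of arrival: `Fin n` is
the set of arrival times. It records what can be observed: the label of each element (its visible
identity), the independence oracle and the value oracle. -/
structure OrderedInput (Λ : Type w) (n : ℕ) where
  label : Fin n → Λ
  indep : Finset (Fin n) → Prop
  value : Finset (Fin n) → ℝ

/-- `I` and `J` cannot be distinguished by what is available when element `t` has just arrived:
labels of arrived elements and oracle answers on sets of arrived elements. -/
def OrderedInput.AgreeUpTo {Λ : Type w} {n : ℕ} (t : Fin n) (I J : OrderedInput Λ n) : Prop :=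
  (∀ i, i ≤ t → I.label i = J.label i) ∧
    ∀ S : Finset (Fin n), (∀ i ∈ S, i ≤ t) → (I.indep S ↔ J.indep S) ∧ I.value S = J.value S

/-- A randomized online algorithm which knows the number `n` of elements in advance. It draws a
random seed, and for every value of the seed it accepts a set of elements, where the irrevocable
decision about the element arriving at time `t` depends only on what is available at time `t`. -/
structure OnlineAlgorithm (Λ : Type w) where
  Seed : ℕ → Type v
  [seedSpace : ∀ n, MeasurableSpace (Seed n)]
  prob : ∀ n, Measure (Seed n)
  [isProb : ∀ n, IsProbabilityMeasure (prob n)]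
  accept : ∀ n, Seed n → OrderedInput Λ n → Finset (Fin n)
  online : ∀ (n : ℕ) (s : Seed n) (t : Fin n) (I J : OrderedInput Λ n),
    I.AgreeUpTo t J → (t ∈ accept n s I ↔ t ∈ accept n s J)
  measurable_accept : ∀ (n : ℕ) (I : OrderedInput Λ n) (T : Finset (Fin n)),
    MeasurableSet {s | accept n s I = T}

attribute [instance] OnlineAlgorithm.seedSpace OnlineAlgorithm.isProb

/-- Non-negative set functions with diminishing returns. -/
structure IsNonnegSubmodular {E : Type u} (f : Finset E → ℝ) : Prop where
  nonneg : ∀ S, 0 ≤ f S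
  diminishing : ∀ [DecidableEq E] (A B : Finset E) (e : E), A ⊆ B → e ∉ B →
    f (insert e B) - f B ≤ f (insert e A) - f A

/-- The linear set function with weights `wt`. -/
def linearValue {E : Type u} (wt : E → ℝ) (S : Finset E) : ℝ := ∑ e ∈ S, wt e

section Instances

variable {Λ : Type w} {E : Type u} [Fintype E]

/-- The instance with matroid `M`, labels `lab` and objective `f`, its elements arriving in the
order `π`. -/
def orderedInput (M : Matroid E) (lab : E → Λ) (f : Finset E → ℝ)
    (π : Fin (Fintype.card E) ≃ E) : OrderedInput Λ (Fintype.card E) where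
  label i := lab (π i)
  indep S := M.Indep (S.map π.toEmbedding : Finset E)
  value S := f (S.map π.toEmbedding)

namespace OnlineAlgorithm

/-- The set of elements that `A` accepts with seed `s` and arrival order `π`. -/
def output (A : OnlineAlgorithm.{v, w} Λ) (M : Matroid E) (lab : E → Λ) (f : Finset E → ℝ)
    (π : Fin (Fintype.card E) ≃ E) (s : A.Seed (Fintype.card E)) : Finset E :=
  (A.accept (Fintype.card E) s (orderedInput M lab f π)).map π.toEmbedding

/-- The algorithm always accepts an independent set on this instance. -/
def FeasibleOn (A : OnlineAlgorithm.{v, w} Λ) (M : Matroid E) (lab : E → Λ)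
    (f : Finset E → ℝ) : Prop :=
  ∀ (π : Fin (Fintype.card E) ≃ E) (s : A.Seed (Fintype.card E)),
    M.Indep (A.output M lab f π s : Finset E)

open Classical in
/-- The expected value of the accepted set, over a uniformly random arrival order and, independently,
the random seed. (The integrand is measurable and takes finitely many values.) -/
noncomputable def expectedValue (A : OnlineAlgorithm.{v, w} Λ) (M : Matroid E) (lab : E → Λ)
    (f : Finset E → ℝ) : ℝ :=
  (1 / (Fintype.card (Fin (Fintype.card E) ≃ E) : ℝ)) *
    ∑ π : Fin (Fintype.card E) ≃ E,
      ∫ s, f (A.output M lab f π s) ∂(A.prob (Fintype.card E))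

/-- The expected value of the accepted set is at least `1 / c` times the value of every independent
set, that is, at least `1 / c` times the offline optimum. -/
def CompetitiveOn (A : OnlineAlgorithm.{v, w} Λ) (M : Matroid E) (lab : E → Λ)
    (f : Finset E → ℝ) (c : ℝ) : Prop :=
  ∀ S : Finset E, M.Indep (S : Set E) → (1 / c) * f S ≤ A.expectedValue M lab f

/-- `c`-competitive for the matroid secretary problem on the matroid `M`. -/
def MSPCompetitive (A : OnlineAlgorithm.{v, w} Λ) (M : Matroid E) (lab : E → Λ) (c : ℝ) : Prop :=
  ∀ wt : E → ℝ, (∀ e, 0 ≤ wt e) → A.CompetitiveOn M lab (linearValue wt) c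

/-- `c`-competitive for the submodular matroid secretary problem on the matroid `M`. -/
def SMSPCompetitive (A : OnlineAlgorithm.{v, w} Λ) (M : Matroid E) (lab : E → Λ) (c : ℝ) : Prop :=
  ∀ f : Finset E → ℝ, IsNonnegSubmodular f → A.CompetitiveOn M lab f c

end OnlineAlgorithm

end Instances

/-- An algorithm for the matroid secretary problem: on every instance with non-negative weights it
accepts an independent set. -/
def OnlineAlgorithm.IsMSPAlgorithm {Λ : Type w} (A : OnlineAlgorithm.{v, w} Λ) : Prop :=
  ∀ (E : Type u) [Fintype E] (M : Matroid E) (lab : E → Λ) (wt : E → ℝ),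
    M.E = Set.univ → (∀ e, 0 ≤ wt e) → A.FeasibleOn M lab (linearValue wt)

/-- An algorithm for the submodular matroid secretary problem: on every instance with a non-negative
submodular objective it accepts an independent set. -/
def OnlineAlgorithm.IsSMSPAlgorithm {Λ : Type w} (A : OnlineAlgorithm.{v, w} Λ) : Prop :=
  ∀ (E : Type u) [Fintype E] (M : Matroid E) (lab : E → Λ) (f : Finset E → ℝ),
    M.E = Set.univ → IsNonnegSubmodular f → A.FeasibleOn M lab f

/-! Every element gets one of 2m equally likely colours; m of them form a sample L, one other colour
marks a thinned set T. Greedy is simulated on the whole ground set: it repeatedly considers the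
feasible element of largest positive marginal value with respect to the considered elements of L,
and keeps it only if it lies in L. A considered element of T gets its marginal value at that moment
as weight, all other elements get weight zero, and `Linear` is run on these weights; accepted
elements of positive weight are kept. Elements outside L do not influence the run, so the weight of
u is computable from L and u alone (`visitSum_run_restrict`).

Whether and in which state greedy considers u does not depend on the colour of u. Hence sums of
functions of the state over the considered elements of L are, summed over all colourings, m times
those over T (`colorSum_eq`). Summed over colourings, let W be the weight of the greedy solution, G
the weight of the considered elements of T not spanned by earlier considered ones of T, Λ the
decrease of marginal values on the greedy solution caused by earlier considered elements of T, F the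
value of the empty set and O the optimum. Three inequalities carry the argument: (1) O ≤ 2 (F + 3W),
as greedy solutions of complementary samples are disjoint (`card_mul_le_sum_union`) and greedy is
near-optimal (`value_union_le`); (2) W ≤ (m + 1) G: the unspanned part of W is m G by colour
exchange, the spanned part is at most G by comparing ranks of superlevel sets (`sum_spanned_le`);
(3) (m + 1) Λ ≤ 2W + F, as adding a random one of m disjoint thinned sets costs on average at most a
1/m fraction of the value (`sum_sample_le_sum_union`). The unspanned elements are independent, so
`Linear` gains weight at least G / α, while the loss on T is Λ / m (`le_value_of_subset`). The gain
is of order W / (α m) and the loss of order 2W / m², so m = ⌈3α⌉ suffices (`combine_bounds`).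

To run this online, the first arrivals serve as the sample, but are shown to `Linear` at random
positions of a simulated order. Greedy breaks ties by random ranks, so that the weights are
independent of that order, which is uniform (`sum_trans_eq`); the guarantee of `Linear` then applies
for fixed ranks and colours (`guarantee_le_sum_integral`). -/

namespace SimulatedGreedy

/-! ### The simulated greedy run as a list of considered elements. -/

section Run

variable {V : Type*} [LinearOrder V]

/-- The marginal value of `u` with respect to `S`. -/
def gain (f : Finset V → ℝ) (S : Finset V) (u : V) : ℝ := f (insert u S) - f S

open Classical in
/-- The elements of the pool `R` that greedy may add to `S`. -/
noncomputable def candidates (ind : Finset V → Prop) (f : Finset V → ℝ) (R S : Finset V) :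
    Finset V :=
  R.filter fun u => ind (insert u S) ∧ 0 < gain f S u

/-- `u` is the candidate of largest marginal value, ties being broken by the order of `V`. -/
def IsNext (ind : Finset V → Prop) (f : Finset V → ℝ) (R S : Finset V) (u : V) : Prop :=
  u ∈ candidates ind f R S ∧
    ∀ v ∈ candidates ind f R S, toLex (gain f S v, v) ≤ toLex (gain f S u, u)

open Classical in
/-- The next element considered by greedy, if there is one. -/
noncomputable def next (ind : Finset V → Prop) (f : Finset V → ℝ) (R S : Finset V) : Option V :=
  if h : ∃ u, IsNext ind f R S u then some h.choose else none

variable {ind : Finset V → Prop} {f : Finset V → ℝ} {L R S C : Finset V} {u v : V}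

lemma mem_candidates :
    u ∈ candidates ind f R S ↔ u ∈ R ∧ ind (insert u S) ∧ 0 < gain f S u := by
  classical simp [candidates]

lemma IsNext.unique (h : IsNext ind f R S u) (h' : IsNext ind f R S v) : u = v := by
  have := le_antisymm (h.2 v h'.1) (h'.2 u h.1)
  have := congrArg (fun x => (ofLex x).2) this
  exact this.symm

lemma next_eq_some : next ind f R S = some u ↔ IsNext ind f R S u := by
  unfold next
  split_ifs with h
  · constructor
    · intro e
      have := Option.some.inj e
      exact this ▸ h.choose_spec
    · intro hu
      exact congrArg some (h.choose_spec.unique hu)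
  · simp only [false_iff]
    exact fun hu => h ⟨u, hu⟩

lemma next_eq_none : next ind f R S = none ↔ candidates ind f R S = ∅ := by
  constructor
  · intro h
    by_contra hne
    obtain ⟨u, hu, hmax⟩ := Finset.exists_max_image _ (fun u => toLex (gain f S u, u))
      (Finset.nonempty_iff_ne_empty.2 hne)
    have : next ind f R S = some u := next_eq_some.2 ⟨hu, hmax⟩
    simp [h] at this
  · intro h
    by_contra hne
    obtain ⟨u, hu⟩ := Option.ne_none_iff_exists'.1 hne
    have := (next_eq_some.1 hu).1
    simp [h] at this

lemma next_mem (h : next ind f R S = some u) : u ∈ R :=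
  (mem_candidates.1 (next_eq_some.1 h).1).1

lemma IsNext.mono {R' : Finset V} (h : IsNext ind f R S u) (hR : R' ⊆ R) (hu : u ∈ R') :
    IsNext ind f R' S u := by
  refine ⟨mem_candidates.2 ⟨hu, (mem_candidates.1 h.1).2⟩, fun v hv => h.2 v ?_⟩
  rw [mem_candidates] at hv ⊢
  exact ⟨hR hv.1, hv.2⟩

variable (ind f L) in
/-- The run of the simulated greedy procedure with sample `L`, pool `R` and set `C` of elements
considered so far. Greedy keeps the considered elements that lie in `L`. The run lists the
elements that are considered, each with the set of those considered before. -/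
noncomputable def run (R C : Finset V) : List (V × Finset V) :=
  match _h : next ind f R (C ∩ L) with
  | none => []
  | some u => (u, C) :: run (R.erase u) (insert u C)
termination_by R.card
decreasing_by exact Finset.card_erase_lt_of_mem (next_mem _h)

lemma run_of_none (h : next ind f R (C ∩ L) = none) : run ind f L R C = [] := by
  rw [run]
  split
  · rfl
  · simp_all

lemma run_of_some (h : next ind f R (C ∩ L) = some u) :
    run ind f L R C = (u, C) :: run ind f L (R.erase u) (insert u C) := by
  rw [run]
  split
  · simp_all
  · simp_all

lemma run_induction (ind : Finset V → Prop) (f : Finset V → ℝ) (L : Finset V)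
    {p : Finset V → Finset V → Prop}
    (hnone : ∀ R C, next ind f R (C ∩ L) = none → p R C)
    (hsome : ∀ R C u, u ∈ R → next ind f R (C ∩ L) = some u → p (R.erase u) (insert u C) → p R C)
    (R C : Finset V) : p R C := by
  induction hn : R.card using Nat.strong_induction_on generalizing R C with
  | _ n ih =>
    cases h : next ind f R (C ∩ L) with
    | none => exact hnone R C h
    | some u =>
      refine hsome R C u (next_mem h) h (ih _ ?_ _ _ rfl)
      rw [← hn]
      exact Finset.card_erase_lt_of_mem (next_mem h)

/-- The sum of `h` over the occurrences of `u` in a run. -/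
def visitSum (l : List (V × Finset V)) (u : V) (h : Finset V → ℝ) : ℝ :=
  (l.map fun p => if p.1 = u then h p.2 else 0).sum

@[simp] lemma visitSum_nil (h : Finset V → ℝ) : visitSum [] u h = 0 := rfl

@[simp] lemma visitSum_cons (p : V × Finset V) (l : List (V × Finset V)) (h : Finset V → ℝ) :
    visitSum (p :: l) u h = (if p.1 = u then h p.2 else 0) + visitSum l u h := by
  simp [visitSum]

lemma mem_pool_of_mem_run {p : V × Finset V} (hp : p ∈ run ind f L R C) : p.1 ∈ R := by
  revert hp
  refine run_induction ind f L (p := fun R C => p ∈ run ind f L R C → p.1 ∈ R) ?_ ?_ R C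
  · intro R C h
    simp [run_of_none h]
  · intro R C u hu h ih hp
    rw [run_of_some h, List.mem_cons] at hp
    rcases hp with rfl | hp
    · exact hu
    · exact Finset.mem_of_mem_erase (ih hp)

lemma visitSum_eq_zero {l : List (V × Finset V)} (h : Finset V → ℝ) (hu : ∀ p ∈ l, p.1 ≠ u) :
    visitSum l u h = 0 := by
  induction l with
  | nil => rfl
  | cons p l ih => simp_all

lemma visitSum_run_erase (h : Finset V → ℝ) :
    visitSum (run ind f L (R.erase u) C) u h = 0 :=
  visitSum_eq_zero h fun _ hp e => (Finset.mem_erase.1 (mem_pool_of_mem_run hp)).1 e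

/-- Elements outside the sample can be removed from the pool without effect on the others. -/
lemma visitSum_run_restrict {R' C' : Finset V} (h : Finset V → ℝ)
    (hR : R' ⊆ R) (hL : ∀ v ∈ R, v ∈ L → v ∈ R') (hC : C' ∩ L = C ∩ L) (hu : u ∈ R') :
    visitSum (run ind f L R' C') u (fun D => h (D ∩ L)) =
      visitSum (run ind f L R C) u (fun D => h (D ∩ L)) := by
  revert R' C'
  refine run_induction ind f L (p := fun R C => ∀ {R' C' : Finset V}, R' ⊆ R →
    (∀ v ∈ R, v ∈ L → v ∈ R') → C' ∩ L = C ∩ L → u ∈ R' →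
    visitSum (run ind f L R' C') u (fun D => h (D ∩ L)) =
      visitSum (run ind f L R C) u (fun D => h (D ∩ L))) ?_ ?_ R C
  · intro R C hn R' C' hR hL hC hu
    rw [run_of_none hn, run_of_none]
    rw [hC]
    rw [next_eq_none, Finset.eq_empty_iff_forall_notMem] at hn ⊢
    intro v hv
    refine hn v ?_
    rw [mem_candidates] at hv ⊢
    exact ⟨hR hv.1, hv.2⟩
  · intro R C v hv hn ih R' C' hR hL hC hu
    rw [run_of_some hn]
    by_cases hvR : v ∈ R'
    · have hn' : next ind f R' (C' ∩ L) = some v := by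
        rw [hC]
        exact next_eq_some.2 ((next_eq_some.1 hn).mono hR hvR)
      rw [run_of_some hn', visitSum_cons, visitSum_cons]
      simp only [hC]
      by_cases hvu : v = u
      · subst hvu
        rw [visitSum_run_erase, visitSum_run_erase]
      · congr 1
        refine ih (Finset.erase_subset_erase v hR) ?_ ?_ (Finset.mem_erase.2 ⟨Ne.symm hvu, hu⟩)
        · intro x hx hxL
          rw [Finset.mem_erase] at hx ⊢
          exact ⟨hx.1, hL x hx.2 hxL⟩
        · by_cases hvL : v ∈ L
          · rw [Finset.insert_inter_of_mem hvL, Finset.insert_inter_of_mem hvL, hC]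
          · rw [Finset.insert_inter_of_notMem hvL, Finset.insert_inter_of_notMem hvL, hC]
    -- The larger run considers an element absent from the smaller pool. It is not in the sample, so
    -- greedy discards it and the state `C ∩ L` stays the same.
    · have hvL : v ∉ L := fun h => hvR (hL v hv h)
      have hvu : v ≠ u := fun e => hvR (e ▸ hu)
      rw [visitSum_cons, if_neg hvu, zero_add]
      refine ih ?_ ?_ ?_ hu
      · intro x hx
        exact Finset.mem_erase.2 ⟨fun e => hvR (e ▸ hx), hR hx⟩
      · intro x hx hxL
        exact hL x (Finset.mem_of_mem_erase hx) hxL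
      · rw [Finset.insert_inter_of_notMem hvL, hC]

/-- A run only queries the oracles on subsets of the pool and the sample. -/
lemma run_congr {ind' : Finset V → Prop} {f' : Finset V → ℝ} {B : Finset V}
    (hi : ∀ S ⊆ B, (ind S ↔ ind' S)) (hf : ∀ S ⊆ B, f S = f' S) (hR : R ⊆ B) (hL : L ⊆ B) :
    run ind f L R C = run ind' f' L R C := by
  have key : ∀ (R C : Finset V), R ⊆ B → ∀ u, IsNext ind f R (C ∩ L) u ↔
      IsNext ind' f' R (C ∩ L) u := by
    intro R C hR u
    have hg : ∀ v ∈ R, gain f (C ∩ L) v = gain f' (C ∩ L) v := by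
      intro v hv
      have h1 : C ∩ L ⊆ B := Finset.inter_subset_right.trans hL
      rw [gain, gain, hf _ h1, hf _ (Finset.insert_subset (hR hv) h1)]
    have hc : candidates ind f R (C ∩ L) = candidates ind' f' R (C ∩ L) := by
      ext v
      simp only [mem_candidates]
      constructor
      · rintro ⟨h1, h2, h3⟩
        refine ⟨h1, (hi _ ?_).1 h2, hg v h1 ▸ h3⟩
        exact Finset.insert_subset (hR h1) (Finset.inter_subset_right.trans hL)
      · rintro ⟨h1, h2, h3⟩
        refine ⟨h1, (hi _ ?_).2 h2, (hg v h1).symm ▸ h3⟩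
        exact Finset.insert_subset (hR h1) (Finset.inter_subset_right.trans hL)
    unfold IsNext
    rw [hc]
    refine and_congr_right fun hu => forall₂_congr fun v hv => ?_
    rw [hg v (mem_candidates.1 hv).1, hg u (mem_candidates.1 hu).1]
  revert hR
  refine run_induction ind f L (p := fun R C => R ⊆ B →
    run ind f L R C = run ind' f' L R C) ?_ ?_ R C
  · intro R C h hR
    have h' : next ind' f' R (C ∩ L) = none := by
      by_contra hne
      obtain ⟨u, hu⟩ := Option.ne_none_iff_exists'.1 hne
      rw [next_eq_some.2 ((key R C hR u).2 (next_eq_some.1 hu))] at h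
      simp at h
    rw [run_of_none h, run_of_none h']
  · intro R C u hu h ih hR
    have h' := next_eq_some.2 ((key R C hR u).1 (next_eq_some.1 h))
    rw [run_of_some h, run_of_some h', ih ((Finset.erase_subset u R).trans hR)]

/-- Whether and when `u` is considered does not depend on whether `u` is in the sample. -/
lemma visitSum_run_sample_congr {L' : Finset V} (h : Finset V → ℝ)
    (hL : ∀ v, v ≠ u → (v ∈ L ↔ v ∈ L')) (hu : u ∉ C) :
    visitSum (run ind f L R C) u h = visitSum (run ind f L' R C) u h := by
  revert hu
  refine run_induction ind f L (p := fun R C => u ∉ C →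
    visitSum (run ind f L R C) u h = visitSum (run ind f L' R C) u h) ?_ ?_ R C
  all_goals
    intro R C
    have hC : u ∉ C → C ∩ L = C ∩ L' := by
      intro hu
      ext v
      simp only [Finset.mem_inter]
      exact and_congr_right fun hv => hL v fun e => hu (e ▸ hv)
  · intro hn hu
    rw [run_of_none hn, run_of_none (hC hu ▸ hn)]
  · intro v hv hn ih hu
    have hn' : next ind f R (C ∩ L') = some v := hC hu ▸ hn
    rw [run_of_some hn, run_of_some hn', visitSum_cons, visitSum_cons]
    by_cases hvu : v = u
    · subst hvu
      rw [visitSum_run_erase, visitSum_run_erase]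
    · rw [ih]
      simp [hu, Ne.symm hvu]


/-! ### Complete runs: the considered elements and their chronological order. -/

variable [Fintype V] {p q : V × Finset V} {g : Finset V → ℝ} {A : Finset V}

/-- Invariant: the pool remains the complement of the set considered so far, which only grows. -/
lemma isNext_of_mem_run (hp : p ∈ run ind f L Cᶜ C) :
    C ⊆ p.2 ∧ IsNext ind f p.2ᶜ (p.2 ∩ L) p.1 := by
  have key : ∀ R C : Finset V, R = Cᶜ → p ∈ run ind f L R C →
      C ⊆ p.2 ∧ IsNext ind f p.2ᶜ (p.2 ∩ L) p.1 := by
    refine run_induction ind f L ?_ ?_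
    · intro R C h
      simp [run_of_none h]
    · intro R C u hu h ih hR hp
      rw [run_of_some h, List.mem_cons] at hp
      rcases hp with rfl | hp
      · exact ⟨subset_rfl, hR ▸ next_eq_some.1 h⟩
      · obtain ⟨h1, h2⟩ := ih (by rw [hR, Finset.compl_insert]) hp
        exact ⟨(Finset.subset_insert u C).trans h1, h2⟩
  exact key _ _ rfl hp

lemma run_compl_of_some (h : next ind f Cᶜ (C ∩ L) = some u) :
    run ind f L Cᶜ C = (u, C) :: run ind f L (insert u C)ᶜ (insert u C) := by
  rw [run_of_some h, Finset.compl_insert]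

lemma run_compl_induction (ind : Finset V → Prop) (f : Finset V → ℝ) (L : Finset V)
    {p : Finset V → Prop}
    (hnone : ∀ C, next ind f Cᶜ (C ∩ L) = none → p C)
    (hsome : ∀ C u, u ∉ C → next ind f Cᶜ (C ∩ L) = some u → p (insert u C) → p C)
    (C : Finset V) : p C := by
  have := run_induction ind f L (p := fun R C => R = Cᶜ → p C)
    (fun R C h e => hnone C (e ▸ h))
    (fun R C u hu h ih e => hsome C u (Finset.mem_compl.1 (e ▸ hu)) (e ▸ h)
      (ih (by rw [e, Finset.compl_insert])))
  exact this _ C rfl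

lemma run_total (hp : p ∈ run ind f L Cᶜ C) (hq : q ∈ run ind f L Cᶜ C) :
    p = q ∨ insert p.1 p.2 ⊆ q.2 ∨ insert q.1 q.2 ⊆ p.2 := by
  revert hp hq
  refine run_compl_induction ind f L (p := fun C => p ∈ run ind f L Cᶜ C → q ∈ run ind f L Cᶜ C →
    p = q ∨ insert p.1 p.2 ⊆ q.2 ∨ insert q.1 q.2 ⊆ p.2) ?_ ?_ C
  · intro C h
    simp [run_of_none h]
  · intro C u hu h ih hp hq
    rw [run_compl_of_some h, List.mem_cons] at hp hq
    rcases hp with rfl | hp <;> rcases hq with rfl | hq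
    · exact Or.inl rfl
    · exact Or.inr (Or.inl (isNext_of_mem_run hq).1)
    · exact Or.inr (Or.inr (isNext_of_mem_run hp).1)
    · exact ih hp hq

lemma nodup_run : ((run ind f L Cᶜ C).map Prod.fst).Nodup := by
  refine run_compl_induction ind f L (p := fun C => ((run ind f L Cᶜ C).map Prod.fst).Nodup)
    ?_ ?_ C
  · intro C h
    simp [run_of_none h]
  · intro C u hu h ih
    rw [run_compl_of_some h, List.map_cons, List.nodup_cons]
    refine ⟨?_, ih⟩
    simp only [List.mem_map, not_exists, not_and]
    rintro p hp rfl
    have := mem_pool_of_mem_run hp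
    simp at this

lemma mem_of_mem_run (hp : p ∈ run ind f L Cᶜ C) (hv : v ∈ p.2) :
    v ∈ C ∨ ∃ D, (v, D) ∈ run ind f L Cᶜ C := by
  revert hp
  refine run_compl_induction ind f L (p := fun C => p ∈ run ind f L Cᶜ C →
    v ∈ C ∨ ∃ D, (v, D) ∈ run ind f L Cᶜ C) ?_ ?_ C
  · intro C h
    simp [run_of_none h]
  · intro C u hu h ih hp
    rw [run_compl_of_some h, List.mem_cons] at hp
    rw [run_compl_of_some h]
    rcases hp with rfl | hp
    · exact Or.inl hv
    · rcases ih hp with h | ⟨D, hD⟩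
      · rcases Finset.mem_insert.1 h with rfl | h
        · exact Or.inr ⟨C, by simp⟩
        · exact Or.inl h
      · exact Or.inr ⟨D, List.mem_cons_of_mem _ hD⟩

variable (ind f L) in
/-- The elements considered by greedy with sample `L`. -/
noncomputable def visited : Finset V := ((run ind f L ∅ᶜ ∅).map Prod.fst).toFinset

open Classical in
variable (ind f L) in
/-- The elements considered before `u`. -/
noncomputable def before (u : V) : Finset V :=
  if h : ∃ C, (u, C) ∈ run ind f L ∅ᶜ ∅ then h.choose else ∅

lemma mem_visited : u ∈ visited ind f L ↔ ∃ C, (u, C) ∈ run ind f L ∅ᶜ ∅ := by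
  simp [visited]

lemma mem_run_before (hu : u ∈ visited ind f L) :
    (u, before ind f L u) ∈ run ind f L ∅ᶜ ∅ := by
  rw [mem_visited] at hu
  rw [before, dif_pos hu]
  exact hu.choose_spec

lemma isNext_before (hu : u ∈ visited ind f L) :
    IsNext ind f (before ind f L u)ᶜ (before ind f L u ∩ L) u :=
  (isNext_of_mem_run (mem_run_before hu)).2

lemma notMem_before (hu : u ∈ visited ind f L) : u ∉ before ind f L u :=
  Finset.mem_compl.1 (mem_candidates.1 (isNext_before hu).1).1

lemma before_subset (hu : u ∈ visited ind f L) : before ind f L u ⊆ visited ind f L := by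
  intro v hv
  rcases mem_of_mem_run (mem_run_before hu) hv with h | h
  · simp at h
  · exact mem_visited.2 h

lemma before_total (hu : u ∈ visited ind f L) (hv : v ∈ visited ind f L) :
    u = v ∨ insert u (before ind f L u) ⊆ before ind f L v ∨
      insert v (before ind f L v) ⊆ before ind f L u := by
  rcases run_total (mem_run_before hu) (mem_run_before hv) with h | h
  · exact Or.inl (congrArg Prod.fst h)
  · exact Or.inr h

lemma insert_before_subset (hu : u ∈ visited ind f L) (hv : v ∈ before ind f L u) :
    insert v (before ind f L v) ⊆ before ind f L u := by
  have hv' := before_subset hu hv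
  rcases before_total hu hv' with rfl | h | h
  · exact absurd hv (notMem_before hu)
  · exact absurd (h (Finset.mem_insert_of_mem hv)) (notMem_before hv')
  · exact h

lemma card_before_lt (hu : u ∈ visited ind f L) (hv : v ∈ before ind f L u) :
    (before ind f L v).card < (before ind f L u).card := by
  have := Finset.card_le_card (insert_before_subset hu hv)
  rw [Finset.card_insert_of_notMem (notMem_before (before_subset hu hv))] at this
  omega

lemma mem_before_of_card_le (hu : u ∈ visited ind f L) (hv : v ∈ visited ind f L) (hne : v ≠ u)
    (h : (before ind f L v).card ≤ (before ind f L u).card) : v ∈ before ind f L u := by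
  rcases before_total hu hv with rfl | h' | h'
  · exact absurd rfl hne
  · have := card_before_lt hv (h' (Finset.mem_insert_self _ _))
    omega
  · exact h' (Finset.mem_insert_self _ _)

/-- At the end of the run there is no candidate left. -/
lemma candidates_visited : candidates ind f (visited ind f L)ᶜ (visited ind f L ∩ L) = ∅ := by
  have key : ∀ C : Finset V, candidates ind f
      (C ∪ ((run ind f L Cᶜ C).map Prod.fst).toFinset)ᶜ
      ((C ∪ ((run ind f L Cᶜ C).map Prod.fst).toFinset) ∩ L) = ∅ := by
    refine run_compl_induction ind f L ?_ ?_
    · intro C h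
      rw [run_of_none h]
      simpa using next_eq_none.1 h
    · intro C u hu h ih
      rw [run_compl_of_some h]
      simpa using ih
  simpa [visited] using key ∅

/-- No element is considered twice, so the sum has at most one nonzero term. This turns invariance
of `visitSum` for all `h` into invariance of both `visited` and `before`. -/
lemma visitSum_run (h : Finset V → ℝ) :
    visitSum (run ind f L ∅ᶜ ∅) u h =
      if u ∈ visited ind f L then h (before ind f L u) else 0 := by
  split_ifs with hu
  · have key : ∀ (l : List (V × Finset V)) (C : Finset V), (l.map Prod.fst).Nodup → (u, C) ∈ l →
        visitSum l u h = h C := by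
      intro l C hl hC
      induction l with
      | nil => simp at hC
      | cons p l ih =>
        rw [List.map_cons, List.nodup_cons] at hl
        rw [visitSum_cons]
        rcases List.mem_cons.1 hC with rfl | hC
        · rw [visitSum_eq_zero, if_pos rfl, add_zero]
          exact fun p hp e => hl.1 (List.mem_map.2 ⟨p, hp, e⟩)
        · rw [ih hl.2 hC, if_neg, zero_add]
          exact fun e => hl.1 (List.mem_map.2 ⟨_, hC, e.symm⟩)
    exact key _ _ nodup_run (mem_run_before hu)
  · refine visitSum_eq_zero h fun p hp e => hu (mem_visited.2 ⟨p.2, ?_⟩)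
    rwa [← e]

lemma sum_run (F : V → Finset V → ℝ) :
    ((run ind f L ∅ᶜ ∅).map fun p => F p.1 p.2).sum =
      ∑ u ∈ visited ind f L, F u (before ind f L u) := by
  have key : ∀ l : List (V × Finset V), (l.map fun p => F p.1 p.2).sum =
      ∑ u, visitSum l u (F u) := by
    intro l
    induction l with
    | nil => simp
    | cons p l ih => simp [ih, Finset.sum_add_distrib]
  rw [key]
  simp only [visitSum_run, Finset.sum_ite_mem, Finset.univ_inter]

/-- The value of the considered elements that lie in `A`, as a sum of marginal values. -/
lemma sum_gain_visited (g : Finset V → ℝ) (A : Finset V) :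
    ∑ u ∈ visited ind f L ∩ A, gain g (before ind f L u ∩ A) u =
      g (visited ind f L ∩ A) - g ∅ := by
  have key : ∀ C : Finset V,
      ((run ind f L Cᶜ C).map fun p => if p.1 ∈ A then gain g (p.2 ∩ A) p.1 else 0).sum =
        g ((C ∪ ((run ind f L Cᶜ C).map Prod.fst).toFinset) ∩ A) - g (C ∩ A) := by
    refine run_compl_induction ind f L ?_ ?_
    · intro C h
      simp [run_of_none h]
    · intro C u hu h ih
      rw [run_compl_of_some h, List.map_cons, List.sum_cons, ih]
      have : (C ∪ (List.map Prod.fst ((u, C) ::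
          run ind f L (insert u C)ᶜ (insert u C))).toFinset) =
          insert u C ∪ (List.map Prod.fst (run ind f L (insert u C)ᶜ (insert u C))).toFinset := by
        simp
      rw [this]
      split_ifs with hA
      · rw [gain, Finset.insert_inter_of_mem hA]
        ring
      · rw [Finset.insert_inter_of_notMem hA]
        ring
  have h := key ∅
  rw [sum_run (fun u C => if u ∈ A then gain g (C ∩ A) u else 0)] at h
  rw [← Finset.sum_filter, Finset.filter_mem_eq_inter] at h
  simpa [visited] using h

end Run

end SimulatedGreedy

/-! ### Comparing weights through superlevel sets and matroid rank. -/

/-- If every superlevel set of `v` on `X` is at most as large as that of `w` on `Y`, then the sum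
of `v` is at most that of the non-negative `w`. -/
lemma Finset.sum_le_sum_of_card_superlevel_le {ι κ : Type*} [DecidableEq ι] [DecidableEq κ]
    {v : ι → ℝ} {w : κ → ℝ} (X : Finset ι) (Y : Finset κ) (hw : ∀ y ∈ Y, 0 ≤ w y)
    (h : ∀ t, 0 < t → (X.filter fun x => t ≤ v x).card ≤ (Y.filter fun y => t ≤ w y).card) :
    ∑ x ∈ X, v x ≤ ∑ y ∈ Y, w y := by
  induction X using Finset.induction_on_max_value v generalizing Y with
  | empty => simpa using Finset.sum_nonneg hw
  | insert a X ha hmax ih =>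
    by_cases hpos : v a ≤ 0
    · refine le_trans (Finset.sum_nonpos fun x hx => ?_) (Finset.sum_nonneg hw)
      rcases Finset.mem_insert.1 hx with rfl | hx
      · exact hpos
      · exact (hmax x hx).trans hpos
    · push Not at hpos
      have h1 := h (v a) hpos
      have h2 : 0 < ((insert a X).filter fun x => v a ≤ v x).card :=
        Finset.card_pos.2 ⟨a, by simp⟩
      obtain ⟨b, hb⟩ := Finset.card_pos.1 (h2.trans_le h1)
      rw [Finset.mem_filter] at hb
      rw [Finset.sum_insert ha, ← Finset.add_sum_erase _ _ hb.1]
      refine add_le_add hb.2 (ih _ (fun y hy => hw y (Finset.mem_of_mem_erase hy)) fun t ht => ?_)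
      -- The maximal `a` is matched with some `b` of at least its value. Up to level `v a` both
      -- superlevel sets lose one element; above it the left one is empty.
      by_cases hta : t ≤ v a
      · have := h t ht
        rw [Finset.filter_insert, if_pos hta, Finset.card_insert_of_notMem (by simp [ha])] at this
        rw [Finset.filter_erase, Finset.card_erase_of_mem (by simp [hb.1, hta.trans hb.2])]
        omega
      · rw [Finset.filter_false_of_mem]
        · simp
        · exact fun x hx hx' => hta (hx'.trans (hmax x hx))

lemma Matroid.Indep.finset_card_le_of_subset_closure {V : Type*} {N : Matroid V} {X Y : Finset V}
    (hX : N.Indep (X : Set V)) (h : (X : Set V) ⊆ N.closure Y) : X.card ≤ Y.card := by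
  have h1 := N.eRk_mono h
  rw [hX.eRk_eq_encard, N.eRk_closure_eq] at h1
  have h2 := h1.trans (N.eRk_le_encard _)
  rw [Set.encard_coe_eq_coe_finsetCard, Set.encard_coe_eq_coe_finsetCard] at h2
  exact_mod_cast h2

namespace SimulatedGreedy

/-! ### Inequalities for submodular functions. -/

section Submodular

variable {V : Type u} [DecidableEq V] {f : Finset V → ℝ}

lemma le_of_submodular (hf : IsNonnegSubmodular f) {A B : Finset V} {u : V} (h : A ⊆ B)
    (hu : u ∉ B) : f (insert u B) - f B ≤ f (insert u A) - f A :=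
  hf.diminishing A B u h hu

lemma union_add_inter_le (hf : IsNonnegSubmodular f) (A B : Finset V) :
    f (A ∪ B) + f (A ∩ B) ≤ f A + f B := by
  have key : ∀ X : Finset V, Disjoint X B → ∀ I : Finset V, I ⊆ B →
      f (B ∪ X) - f B ≤ f (I ∪ X) - f I := by
    intro X
    induction X using Finset.induction_on with
    | empty => simp
    | insert a X ha ih =>
      intro hd I hI
      rw [Finset.disjoint_insert_left] at hd
      have h1 := ih hd.2 I hI
      have h2 := le_of_submodular hf (Finset.union_subset_union_left (t := X) hI)
        (u := a) (by simp [hd.1, ha])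
      rw [Finset.union_insert, Finset.union_insert]
      linarith
  have := key (A \ B) Finset.sdiff_disjoint (A ∩ B) Finset.inter_subset_right
  rw [Finset.union_sdiff_self_eq_union, Finset.union_comm B A,
    Finset.union_comm (A ∩ B), Finset.sdiff_union_inter] at this
  linarith

/-- A non-negative submodular function on a union, bounded by marginal values. -/
lemma union_le_add_sum (hf : IsNonnegSubmodular f) (A X : Finset V) :
    f (A ∪ X) ≤ f A + ∑ x ∈ X \ A, (f (insert x A) - f A) := by
  have key : ∀ Y : Finset V, Disjoint Y A →
      f (A ∪ Y) ≤ f A + ∑ x ∈ Y, (f (insert x A) - f A) := by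
    intro Y
    induction Y using Finset.induction_on with
    | empty => simp
    | insert a Y ha ih =>
      intro hd
      rw [Finset.disjoint_insert_left] at hd
      have h1 := ih hd.2
      have h2 := le_of_submodular hf (Finset.subset_union_left (s₁ := A) (s₂ := Y))
        (u := a) (by simp [hd.1, ha])
      rw [Finset.union_insert, Finset.sum_insert ha]
      linarith
  have := key (X \ A) Finset.sdiff_disjoint
  rwa [Finset.union_sdiff_self_eq_union] at this

/-- Adding pairwise disjoint sets to a set `A`: on average over `k` of them at most a `1 / k`
fraction of the value of `A` is lost. -/
lemma sum_union_ge (hf : IsNonnegSubmodular f) {κ : Type*} [DecidableEq κ] (A : Finset V)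
    (X : κ → Finset V) (hX : Pairwise fun i j => Disjoint (X i) (X j)) (s : Finset κ) :
    ((s.card : ℝ) - 1) * f A ≤ ∑ k ∈ s, f (A ∪ X k) := by
  have key : ((s.card : ℝ) - 1) * f A + f (A ∪ s.biUnion X) ≤ ∑ k ∈ s, f (A ∪ X k) := by
    induction s using Finset.induction_on with
    | empty => simp
    | insert a s ha ih =>
      have h1 := union_add_inter_le hf (A ∪ X a) (A ∪ s.biUnion X)
      have h2 : (A ∪ X a) ∩ (A ∪ s.biUnion X) = A := by
        rw [← Finset.union_inter_distrib_left, Finset.union_eq_left]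
        have : Disjoint (X a) (s.biUnion X) :=
          (Finset.disjoint_biUnion_right _ _ _).2 fun k hk => hX fun e => ha (e ▸ hk)
        rw [Finset.disjoint_iff_inter_eq_empty.1 this]
        exact Finset.empty_subset _
      have h3 : (A ∪ X a) ∪ (A ∪ s.biUnion X) = A ∪ (insert a s).biUnion X := by
        rw [Finset.biUnion_insert, ← Finset.union_union_distrib_left]
      rw [h2, h3] at h1
      rw [Finset.sum_insert ha, Finset.card_insert_of_notMem ha]
      push_cast
      linarith
  linarith [hf.nonneg (A ∪ s.biUnion X)]

end Submodular

/-! ### Weights and losses for a fixed sample. -/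

section Analysis

variable {V : Type u} [LinearOrder V] [Fintype V] {ind : Finset V → Prop} {f : Finset V → ℝ}
  {L T : Finset V} {u v : V}

variable (ind f L) in
/-- The marginal value of `u` with respect to the greedy solution at the time when `u` is
considered. -/
noncomputable def weight (u : V) : ℝ := gain f (before ind f L u ∩ L) u

variable (ind f L T) in
/-- The decrease of the marginal value of `u` caused by the previously considered elements
of `T`. -/
noncomputable def loss (u : V) : ℝ :=
  weight ind f L u - gain f (before ind f L u ∩ (L ∪ T)) u

lemma weight_pos (hu : u ∈ visited ind f L) : 0 < weight ind f L u :=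
  (mem_candidates.1 (isNext_before hu).1).2.2

omit [Fintype V] in
lemma gain_le_of_subset (hf : IsNonnegSubmodular f) {A B : Finset V} (h : A ⊆ B) (hu : u ∉ B) :
    gain f B u ≤ gain f A u :=
  le_of_submodular hf h hu

/-- Greedy chooses the feasible element of largest marginal value. -/
lemma gain_le_weight (hu : u ∈ visited ind f L) (hv : v ∉ before ind f L u)
    (hi : ind (insert v (before ind f L u ∩ L))) :
    gain f (before ind f L u ∩ L) v ≤ weight ind f L u := by
  by_cases hpos : 0 < gain f (before ind f L u ∩ L) v
  · have := (isNext_before hu).2 v (mem_candidates.2 ⟨Finset.mem_compl.2 hv, hi, hpos⟩)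
    rcases Prod.Lex.le_iff.1 this with h | h
    · exact h.le
    · exact h.1.le
  · exact (not_lt.1 hpos).trans (weight_pos hu).le

lemma loss_nonneg (hf : IsNonnegSubmodular f) (hu : u ∈ visited ind f L) :
    0 ≤ loss ind f L T u := by
  refine sub_nonneg.2 (gain_le_of_subset hf
    (Finset.inter_subset_inter_left Finset.subset_union_left) fun h => ?_)
  exact notMem_before hu (Finset.mem_inter.1 h).1

lemma sum_weight : ∑ u ∈ visited ind f L ∩ L, weight ind f L u =
    f (visited ind f L ∩ L) - f ∅ :=
  sum_gain_visited f L

/-- Weight minus loss is the marginal value with respect to the earlier considered elements of `L ∪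
T`, so the sum telescopes. -/
lemma sum_weight_sub_loss : ∑ u ∈ visited ind f L ∩ (L ∪ T),
    (weight ind f L u - loss ind f L T u) = f (visited ind f L ∩ (L ∪ T)) - f ∅ := by
  rw [← sum_gain_visited f (L ∪ T)]
  simp [loss]

/-- The marginals of `Q` telescope, and each is at least the marginal with respect to the earlier
part of `L ∪ T`, which is weight minus loss. The losses are non-negative, so they may be summed over
all considered elements of `T`; the error term is then independent of `Q`, that is, of what the
linear algorithm accepts. -/
lemma le_value_of_subset (hf : IsNonnegSubmodular f) {Q : Finset V}
    (hQ : Q ⊆ visited ind f L ∩ T) :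
    f ∅ + ∑ u ∈ Q, weight ind f L u - ∑ u ∈ visited ind f L ∩ T, loss ind f L T u ≤ f Q := by
  have h1 := sum_gain_visited (ind := ind) (f := f) (L := L) f Q
  rw [Finset.inter_eq_right.2 (hQ.trans Finset.inter_subset_left)] at h1
  have h2 : ∑ u ∈ Q, (weight ind f L u - loss ind f L T u) ≤
      ∑ u ∈ Q, gain f (before ind f L u ∩ Q) u := by
    refine Finset.sum_le_sum fun u hu => ?_
    rw [loss, sub_sub_cancel]
    refine gain_le_of_subset hf (Finset.inter_subset_inter_left ?_) ?_
    · exact (hQ.trans Finset.inter_subset_right).trans Finset.subset_union_right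
    · exact fun h => notMem_before (Finset.mem_inter.1 (hQ hu)).1 (Finset.mem_inter.1 h).1
  have h3 : ∑ u ∈ Q, loss ind f L T u ≤ ∑ u ∈ visited ind f L ∩ T, loss ind f L T u :=
    Finset.sum_le_sum_of_subset_of_nonneg hQ fun u hu _ =>
      loss_nonneg hf (Finset.mem_inter.1 hu).1
  rw [Finset.sum_sub_distrib] at h2
  linarith

/-! ### Greedy and spans in a matroid. -/

section Matroid

variable {N : Matroid V} (hN : N.E = Set.univ) (hind : ∀ S : Finset V, ind S ↔ N.Indep (S : Set V))
include hind

lemma indep_before (hu : u ∈ visited ind f L) :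
    N.Indep ((insert u (before ind f L u ∩ L) : Finset V) : Set V) :=
  (hind _).1 (mem_candidates.1 (isNext_before hu).1).2.1

lemma indep_visited_inter : N.Indep ((visited ind f L ∩ L : Finset V) : Set V) := by
  rcases (visited ind f L ∩ L).eq_empty_or_nonempty with h | h
  · simp [h]
  -- Take the last considered element of the sample: the feasibility test at that moment covers the
  -- whole greedy solution.
  · obtain ⟨u, hu, hmax⟩ := Finset.exists_max_image _ (fun u => (before ind f L u).card) h
    have hu' := (Finset.mem_inter.1 hu).1
    refine (indep_before hind hu').subset ?_
    rw [Finset.coe_subset]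
    intro v hv
    rw [Finset.mem_insert]
    by_cases hvu : v = u
    · exact Or.inl hvu
    · exact Or.inr (Finset.mem_inter.2 ⟨mem_before_of_card_le hu' (Finset.mem_inter.1 hv).1 hvu
        (hmax v hv), (Finset.mem_inter.1 hv).2⟩)

/-- The elements are considered in the order of non-increasing weights. -/
lemma weight_le_weight (hf : IsNonnegSubmodular f) (hv : v ∈ visited ind f L)
    (huv : u ∈ before ind f L v) :
    weight ind f L v ≤ weight ind f L u := by
  have hu := before_subset hv huv
  have hsub := (Finset.subset_insert _ _).trans (insert_before_subset hv huv)
  have h1 : v ∉ before ind f L u := fun h => notMem_before hv (hsub h)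
  refine le_trans (gain_le_of_subset hf (Finset.inter_subset_inter_right hsub) ?_)
    (gain_le_weight hu h1 ?_)
  · exact fun h => notMem_before hv (Finset.mem_inter.1 h).1
  · refine (hind _).2 ((indep_before hind hv).subset ?_)
    rw [Finset.coe_subset]
    exact Finset.insert_subset_insert _ (Finset.inter_subset_inter_right hsub)

omit hind in
open Classical in
variable (ind f L T N) in
/-- The considered elements of `T` that are not spanned by the previous ones. -/
noncomputable def unspanned : Finset V :=
  (visited ind f L ∩ T).filter fun u => u ∉ N.closure ((before ind f L u ∩ T : Finset V) : Set V)

omit hind in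
lemma mem_unspanned : u ∈ unspanned ind f L T N ↔ (u ∈ visited ind f L ∧ u ∈ T) ∧
    u ∉ N.closure ((before ind f L u ∩ T : Finset V) : Set V) := by
  classical rw [unspanned, Finset.mem_filter, Finset.mem_inter]

-- Adding the elements in the order of consideration, each lies outside the span of a superset of
-- those added before it.
omit hind in
include hN in
lemma indep_unspanned : N.Indep ((unspanned ind f L T N : Finset V) : Set V) := by
  have key : ∀ S : Finset V, S ⊆ unspanned ind f L T N → N.Indep (S : Set V) := by
    intro S
    induction S using Finset.induction_on_max_value fun u => (before ind f L u).card with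
    | empty => simp
    | insert a S ha hmax ih =>
      intro hS
      have hS' := (Finset.subset_insert a S).trans hS
      have haS := hS (Finset.mem_insert_self a S)
      rw [mem_unspanned] at haS
      rw [Finset.coe_insert, (ih hS').insert_indep_iff]
      refine Or.inl ⟨by simp [hN], fun h => haS.2 (N.closure_subset_closure ?_ h)⟩
      rw [Finset.coe_subset]
      intro x hx
      have hx' := hS' hx
      rw [mem_unspanned] at hx'
      exact Finset.mem_inter.2 ⟨mem_before_of_card_le haS.1.1 hx'.1.1 (fun e => ha (e ▸ hx))
        (hmax x hx), hx'.1.2⟩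
  exact key _ subset_rfl

-- A spanned element is spanned by earlier elements of `T`, whose weights are no smaller since
-- weights decrease along the run. The unspanned ones of weight at least t span all considered
-- elements of `T` of weight at least t, so the rank bounds the size of each superlevel set.
open Classical in
include hN in
lemma sum_spanned_le (hf : IsNonnegSubmodular f) :
    ∑ u ∈ (visited ind f L ∩ L).filter
        (fun u => u ∈ N.closure ((before ind f L u ∩ T : Finset V) : Set V)), weight ind f L u ≤
      ∑ u ∈ unspanned ind f L T N, weight ind f L u := by
  have hY : ∀ u ∈ unspanned ind f L T N, u ∈ visited ind f L := fun u hu =>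
    (mem_unspanned.1 hu).1.1
  refine Finset.sum_le_sum_of_card_superlevel_le _ _ (fun u hu => (weight_pos (hY u hu)).le)
    fun t ht => ?_
  refine Matroid.Indep.finset_card_le_of_subset_closure (N := N)
    ((indep_visited_inter (f := f) (L := L) hind).subset ?_) ?_
  · rw [Finset.coe_subset]
    exact (Finset.filter_subset _ _).trans (Finset.filter_subset _ _)
  · set Y := (unspanned ind f L T N).filter fun u => t ≤ weight ind f L u with hYdef
    have key : ∀ n : ℕ, ∀ u ∈ visited ind f L ∩ T, t ≤ weight ind f L u →
        (before ind f L u).card = n → u ∈ N.closure (Y : Set V) := by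
      intro n
      induction n using Nat.strong_induction_on with
      | _ n ih =>
        intro u hu htu hn
        have hu' := (Finset.mem_inter.1 hu).1
        by_cases hs : u ∈ N.closure ((before ind f L u ∩ T : Finset V) : Set V)
        -- Strong induction over time: the earlier elements that span `u` are themselves in the
        -- closure of `Y`.
        · refine N.closure_subset_closure_of_subset_closure (fun x hx => ?_) hs
          have hx := Finset.mem_inter.1 (Finset.mem_coe.1 hx)
          exact ih _ (hn ▸ card_before_lt hu' hx.1) x
            (Finset.mem_inter.2 ⟨before_subset hu' hx.1, hx.2⟩)
            (htu.trans (weight_le_weight hind hf hu' hx.1)) rfl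
        · refine N.mem_closure_of_mem ?_ (by simp [hN])
          exact Finset.mem_filter.2 ⟨mem_unspanned.2 ⟨Finset.mem_inter.1 hu, hs⟩, htu⟩
    intro x hx
    simp only [Finset.coe_filter, Set.mem_ofPred_eq, Finset.mem_filter, Finset.mem_inter] at hx
    refine N.closure_subset_closure_of_subset_closure (fun y hy => ?_) hx.1.2
    have hy := Finset.mem_inter.1 (Finset.mem_coe.1 hy)
    exact key _ y (Finset.mem_inter.2 ⟨before_subset hx.1.1.1 hy.1, hy.2⟩)
      (hx.2.trans (weight_le_weight hind hf hx.1.1.1 hy.1)) rfl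

include hN in
/-- The elements of an independent set that are never considered have small marginal values. -/
lemma sum_not_visited_le (hf : IsNonnegSubmodular f) {O : Finset V} (hO : N.Indep (O : Set V)) :
    ∑ o ∈ O \ visited ind f L, gain f (visited ind f L ∩ L) o ≤
      ∑ u ∈ visited ind f L ∩ L, weight ind f L u := by
  refine Finset.sum_le_sum_of_card_superlevel_le _ _
    (fun u hu => (weight_pos (Finset.mem_inter.1 hu).1).le) fun t ht => ?_
  refine Matroid.Indep.finset_card_le_of_subset_closure (N := N) (hO.subset ?_) ?_
  · rw [Finset.coe_subset]
    exact (Finset.filter_subset _ _).trans Finset.sdiff_subset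
  · intro o ho
    simp only [Finset.coe_filter, Set.mem_ofPred_eq, Finset.mem_sdiff] at ho
    obtain ⟨⟨hoO, hoD⟩, hto⟩ := ho
    have hins : ∀ {S : Finset V}, N.Indep (S : Set V) → o ∉ N.closure (S : Set V) →
        ind (insert o S) := by
      intro S hS ho
      rw [hind, Finset.coe_insert, hS.insert_indep_iff]
      exact Or.inl ⟨by simp [hN], ho⟩
    set Y := (visited ind f L ∩ L).filter fun u => t ≤ weight ind f L u
    by_contra hnot
    -- If `o` is not spanned by `Y`, it is feasible when greedy considers its first kept element of
    -- weight below t, or at the end of the run if there is none. Either way greedy should have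
    -- preferred `o`.
    rcases ((visited ind f L ∩ L) \ Y).eq_empty_or_nonempty with h | h
    · have hsub : visited ind f L ∩ L ⊆ Y := Finset.sdiff_eq_empty_iff_subset.1 h
      have h1 : o ∉ N.closure ((visited ind f L ∩ L : Finset V) : Set V) := fun h =>
        hnot (N.closure_subset_closure (Finset.coe_subset.2 hsub) h)
      have h2 : o ∈ candidates ind f (visited ind f L)ᶜ (visited ind f L ∩ L) :=
        mem_candidates.2 ⟨Finset.mem_compl.2 hoD, hins (indep_visited_inter hind) h1,
          ht.trans_le hto⟩
      simp [candidates_visited] at h2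
    · obtain ⟨m, hm, hmin⟩ := Finset.exists_min_image _ (fun u => (before ind f L u).card) h
      have hm1 := Finset.mem_sdiff.1 hm
      have hmD := (Finset.mem_inter.1 hm1.1).1
      have hwm : weight ind f L m < t := by
        by_contra hc
        exact hm1.2 (Finset.mem_filter.2 ⟨hm1.1, not_lt.1 hc⟩)
      have hsub : before ind f L m ∩ L ⊆ Y := by
        intro x hx
        rw [Finset.mem_inter] at hx
        by_contra hxY
        have := hmin x (Finset.mem_sdiff.2
          ⟨Finset.mem_inter.2 ⟨before_subset hmD hx.1, hx.2⟩, hxY⟩)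
        exact absurd (card_before_lt hmD hx.1) (not_lt.2 this)
      have hind' : N.Indep ((before ind f L m ∩ L : Finset V) : Set V) :=
        (indep_before hind hmD).subset (Finset.coe_subset.2 (Finset.subset_insert _ _))
      have h1 := gain_le_weight hmD (fun h => hoD (before_subset hmD h))
        (hins hind' fun h => hnot (N.closure_subset_closure (Finset.coe_subset.2 hsub) h))
      have h2 : gain f (visited ind f L ∩ L) o ≤ gain f (before ind f L m ∩ L) o :=
        gain_le_of_subset hf (Finset.inter_subset_inter_right (before_subset hmD))
          fun h => hoD (Finset.mem_inter.1 h).1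
      linarith

-- The elements of `O` that are never considered add at most the weight of the greedy solution.
-- Those considered and discarded add at most their weights, because marginals only shrink after the
-- time of consideration.
include hN in
lemma value_union_le (hf : IsNonnegSubmodular f) {O : Finset V} (hO : N.Indep (O : Set V)) :
    f (O ∪ visited ind f L ∩ L) ≤ f ∅ + 2 * ∑ u ∈ visited ind f L ∩ L, weight ind f L u +
      ∑ u ∈ visited ind f L \ L, weight ind f L u := by
  have h1 := union_le_add_sum hf (visited ind f L ∩ L) O
  rw [Finset.union_comm] at h1
  have h2 := sum_not_visited_le hN hind hf (L := L) hO
  have h3 : ∑ x ∈ O \ (visited ind f L ∩ L), gain f (visited ind f L ∩ L) x ≤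
      ∑ o ∈ O \ visited ind f L, gain f (visited ind f L ∩ L) o +
        ∑ u ∈ visited ind f L \ L, weight ind f L u := by
    have e : O \ (visited ind f L ∩ L) =
        (O \ visited ind f L) ∪ (O ∩ (visited ind f L \ L)) := by
      ext x
      simp only [Finset.mem_sdiff, Finset.mem_inter, Finset.mem_union]
      tauto
    rw [e, Finset.sum_union]
    · gcongr
      refine le_trans (Finset.sum_le_sum fun x hx => ?_)
        (Finset.sum_le_sum_of_subset_of_nonneg Finset.inter_subset_right
          fun x hx _ => (weight_pos (Finset.mem_sdiff.1 hx).1).le)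
      simp only [Finset.mem_inter, Finset.mem_sdiff] at hx
      refine gain_le_of_subset hf (Finset.inter_subset_inter_right (before_subset hx.2.1)) ?_
      exact fun h => hx.2.2 (Finset.mem_inter.1 h).2
    · rw [Finset.disjoint_left]
      intro x hx hx'
      simp only [Finset.mem_inter, Finset.mem_sdiff] at hx hx'
      exact hx.2 hx'.2.1
  have h4 := sum_weight (ind := ind) (f := f) (L := L)
  simp only [gain] at h3 h2
  linarith

end Matroid

end Analysis

end SimulatedGreedy

namespace SimulatedGreedy

/-! ### Averaging over all colourings. -/

section Colorings

variable {V : Type u} [LinearOrder V] [Fintype V] {m : ℕ}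

/-- The elements coloured `true`: the sample. -/
def sample (c : V → Bool × Fin m) : Finset V := Finset.univ.filter fun v => (c v).1 = true

/-- The elements coloured `(false, k)`. -/
def thinned (c : V → Bool × Fin m) (k : Fin m) : Finset V :=
  Finset.univ.filter fun v => c v = (false, k)

omit [LinearOrder V] in
@[simp] lemma mem_sample {c : V → Bool × Fin m} {v : V} : v ∈ sample c ↔ (c v).1 = true := by
  simp [sample]

omit [LinearOrder V] in
@[simp] lemma mem_thinned {c : V → Bool × Fin m} {k : Fin m} {v : V} :
    v ∈ thinned c k ↔ c v = (false, k) := by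
  simp [thinned]

-- Swapping `a` and `b` at the single coordinate `u` is an involution on colourings that leaves `F`
-- unchanged.
omit [LinearOrder V] in
lemma sum_color_eq [DecidableEq V] {K : Type*} [Fintype K] [DecidableEq K] {u : V}
    {F : (V → K) → ℝ} (hF : ∀ c x, F (Function.update c u x) = F c) (a b : K) :
    (∑ c, if c u = a then F c else 0) = ∑ c, if c u = b then F c else 0 := by
  have hinv : Function.Involutive
      fun c : V → K => Function.update c u (Equiv.swap a b (c u)) := by
    intro c
    simp
  rw [← Equiv.sum_comp hinv.toPerm fun c : V → K => if c u = b then F c else 0]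
  refine Finset.sum_congr rfl fun c _ => ?_
  simp only [Function.Involutive.coe_toPerm, Function.update_self, hF]
  refine if_congr ?_ rfl rfl
  rw [Equiv.swap_apply_eq_iff, Equiv.swap_apply_right]

variable {ind : Finset V → Prop} {f : Finset V → ℝ}

lemma visited_before_congr {L L' : Finset V} {u : V} (hL : ∀ v, v ≠ u → (v ∈ L ↔ v ∈ L')) :
    (u ∈ visited ind f L ↔ u ∈ visited ind f L') ∧
      (u ∈ visited ind f L → before ind f L u = before ind f L' u) := by
  have key := fun h : Finset V → ℝ => visitSum_run_sample_congr (ind := ind) (f := f) (R := ∅ᶜ)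
    (C := ∅) h hL (Finset.notMem_empty u)
  simp only [visitSum_run] at key
  have h1 : u ∈ visited ind f L ↔ u ∈ visited ind f L' := by
    have := key fun _ => 1
    by_cases h : u ∈ visited ind f L <;> by_cases h' : u ∈ visited ind f L' <;> simp_all
  refine ⟨h1, fun h => ?_⟩
  have := key fun C => if C = before ind f L' u then 1 else 0
  rw [if_pos h, if_pos (h1.1 h)] at this
  by_contra hne
  simp [hne] at this

variable (ind f) in
/-- The sum of a function of the state of greedy over the considered elements of a given colour. -/
noncomputable def colorSum (k₀ : Fin m) (h : V → Finset V → Finset V → ℝ) (a : Bool × Fin m) : ℝ :=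
  ∑ c : V → Bool × Fin m, ∑ u ∈ visited ind f (sample c) with c u = a,
    h u (before ind f (sample c) u ∩ sample c) (before ind f (sample c) u ∩ thinned c k₀)

/-- The colour of an element is independent of the state of greedy when it is considered. -/
lemma colorSum_eq (k₀ : Fin m) (h : V → Finset V → Finset V → ℝ) (a b : Bool × Fin m) :
    colorSum ind f k₀ h a = colorSum ind f k₀ h b := by
  have hrw : ∀ a : Bool × Fin m, colorSum ind f k₀ h a = ∑ u : V, ∑ c : V → Bool × Fin m,
      if c u = a then (if u ∈ visited ind f (sample c) then
        h u (before ind f (sample c) u ∩ sample c)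
          (before ind f (sample c) u ∩ thinned c k₀) else 0) else 0 := by
    intro a
    rw [colorSum, Finset.sum_comm]
    refine Finset.sum_congr rfl fun c _ => ?_
    rw [Finset.sum_filter, ← Finset.sum_filter_add_sum_filter_not Finset.univ
      (fun u => u ∈ visited ind f (sample c)) (fun u => if c u = a then _ else _)]
    rw [Finset.sum_congr (s₁ := Finset.univ.filter fun u => u ∉ visited ind f (sample c)) rfl
      (g := fun _ => 0)]
    · rw [Finset.sum_const_zero, add_zero, Finset.filter_mem_eq_inter, Finset.univ_inter]
      refine Finset.sum_congr rfl fun u hu => ?_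
      rw [if_pos hu]
    · intro u hu
      rw [Finset.mem_filter] at hu
      rw [if_neg hu.2, ite_self]
  rw [hrw, hrw]
  refine Finset.sum_congr rfl fun u _ => sum_color_eq (fun c x => ?_) a b
  have hne : ∀ v, v ≠ u → Function.update c u x v = c v := fun v hv => Function.update_of_ne hv _ _
  have hcongr := visited_before_congr (ind := ind) (f := f) (u := u)
    (L := sample (Function.update c u x)) (L' := sample c) fun v hv => by simp [hne v hv]
  by_cases hu : u ∈ visited ind f (sample c)
  · rw [if_pos hu, if_pos (hcongr.1.2 hu), hcongr.2 (hcongr.1.2 hu)]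
    have hb := notMem_before hu
    congr 1 <;>
    · ext v
      simp only [Finset.mem_inter, mem_sample, mem_thinned]
      exact and_congr_right fun hv => by rw [hne v fun e => hb (e ▸ hv)]
  · rw [if_neg hu, if_neg fun h => hu (hcongr.1.1 h)]

lemma sum_visited_thinned (k₀ : Fin m) (h : V → Finset V → Finset V → ℝ) :
    ∑ c : V → Bool × Fin m, ∑ u ∈ visited ind f (sample c) ∩ thinned c k₀,
      h u (before ind f (sample c) u ∩ sample c) (before ind f (sample c) u ∩ thinned c k₀) =
    colorSum ind f k₀ h (false, k₀) := by
  refine Finset.sum_congr rfl fun c _ => Finset.sum_congr ?_ fun _ _ => rfl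
  ext u
  simp

/-- Each value of the Boolean component comprises m colours, all with the same `colorSum`. -/
lemma sum_filter_fst (k₀ : Fin m) (h : V → Finset V → Finset V → ℝ) (b : Bool) :
    ∑ c : V → Bool × Fin m, ∑ u ∈ visited ind f (sample c) with (c u).1 = b,
      h u (before ind f (sample c) u ∩ sample c) (before ind f (sample c) u ∩ thinned c k₀) =
    m * colorSum ind f k₀ h (false, k₀) := by
  have : ∀ k : Fin m, colorSum ind f k₀ h (b, k) = colorSum ind f k₀ h (false, k₀) :=
    fun k => colorSum_eq k₀ h _ _
  have h2 : (m : ℝ) * colorSum ind f k₀ h (false, k₀) =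
      ∑ k : Fin m, colorSum ind f k₀ h (b, k) := by
    simp [this]
  rw [h2]
  simp only [colorSum]
  rw [Finset.sum_comm]
  refine Finset.sum_congr rfl fun c _ => ?_
  simp only [Finset.sum_filter]
  rw [Finset.sum_comm]
  refine Finset.sum_congr rfl fun u _ => ?_
  simp only [Prod.ext_iff, ite_and]
  split_ifs with hb
  · simp
  · simp

lemma sum_visited_sample (k₀ : Fin m) (h : V → Finset V → Finset V → ℝ) :
    ∑ c : V → Bool × Fin m, ∑ u ∈ visited ind f (sample c) ∩ sample c,
      h u (before ind f (sample c) u ∩ sample c) (before ind f (sample c) u ∩ thinned c k₀) =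
    m * colorSum ind f k₀ h (false, k₀) := by
  rw [← sum_filter_fst k₀ h true]
  refine Finset.sum_congr rfl fun c _ => Finset.sum_congr ?_ fun _ _ => rfl
  ext u
  simp

lemma sum_visited_sdiff_sample (k₀ : Fin m) (h : V → Finset V → Finset V → ℝ) :
    ∑ c : V → Bool × Fin m, ∑ u ∈ visited ind f (sample c) \ sample c,
      h u (before ind f (sample c) u ∩ sample c) (before ind f (sample c) u ∩ thinned c k₀) =
    m * colorSum ind f k₀ h (false, k₀) := by
  rw [← sum_filter_fst k₀ h false]
  refine Finset.sum_congr rfl fun c _ => Finset.sum_congr ?_ fun _ _ => rfl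
  ext u
  simp

/-- The greedy solution is disjoint from that for the complementary sample. -/
lemma card_mul_le_sum_union (hf : IsNonnegSubmodular f) (O : Finset V) :
    (Fintype.card (V → Bool × Fin m) : ℝ) * f O ≤
      2 * ∑ c : V → Bool × Fin m, f (O ∪ visited ind f (sample c) ∩ sample c) := by
  -- Flipping the Boolean component replaces the sample by its complement.
  have hinv : Function.Involutive
      fun (c : V → Bool × Fin m) (v : V) => (!(c v).1, (c v).2) := by
    intro c
    simp
  have h1 := Equiv.sum_comp hinv.toPerm fun c : V → Bool × Fin m =>
    f (O ∪ visited ind f (sample c) ∩ sample c)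
  rw [two_mul]
  nth_rewrite 1 [← h1]
  rw [← Finset.sum_add_distrib, ← nsmul_eq_mul, ← Finset.card_univ, ← Finset.sum_const]
  refine Finset.sum_le_sum fun c _ => ?_
  have hd : ∀ D D' : Finset V, D ∩ sample (fun v => (!(c v).1, (c v).2)) ∩ (D' ∩ sample c) = ∅ := by
    intro D D'
    ext v
    simp only [Finset.mem_inter, mem_sample, Finset.notMem_empty, iff_false]
    rintro ⟨⟨_, h1⟩, _, h2⟩
    simp [h2] at h1
  refine le_trans ?_ (union_add_inter_le hf _ _)
  rw [← Finset.union_inter_distrib_left]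
  simp only [Function.Involutive.coe_toPerm, hd, Finset.union_empty]
  exact le_add_of_nonneg_left (hf.nonneg _)

/-- By symmetry `k₀` may be averaged over all `k`; for a fixed colouring the m thinned sets are
disjoint and `sum_union_ge` applies. -/
lemma sum_sample_le_sum_union (hf : IsNonnegSubmodular f) (k₀ : Fin m) :
    ((m : ℝ) - 1) * ∑ c : V → Bool × Fin m, f (visited ind f (sample c) ∩ sample c) ≤
      m * ∑ c : V → Bool × Fin m, f (visited ind f (sample c) ∩ (sample c ∪ thinned c k₀)) := by
  have hperm : ∀ k : Fin m, ∑ c : V → Bool × Fin m,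
      f (visited ind f (sample c) ∩ (sample c ∪ thinned c k)) =
      ∑ c : V → Bool × Fin m, f (visited ind f (sample c) ∩ (sample c ∪ thinned c k₀)) := by
    intro k
    have hinv : Function.Involutive
        fun (c : V → Bool × Fin m) (v : V) => ((c v).1, Equiv.swap k₀ k (c v).2) := by
      intro c
      simp
    rw [← Equiv.sum_comp hinv.toPerm]
    simp only [Function.Involutive.coe_toPerm]
    refine Finset.sum_congr rfl fun c _ => ?_
    have h1 : sample (fun v => ((c v).1, Equiv.swap k₀ k (c v).2)) = sample c := by
      ext v
      simp
    have h2 : thinned (fun v => ((c v).1, Equiv.swap k₀ k (c v).2)) k = thinned c k₀ := by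
      ext v
      simp only [mem_thinned, Prod.ext_iff]
      rw [Equiv.swap_apply_eq_iff, Equiv.swap_apply_right]
    rw [h1, h2]
  have h2 : (m : ℝ) * ∑ c : V → Bool × Fin m,
      f (visited ind f (sample c) ∩ (sample c ∪ thinned c k₀)) =
      ∑ k : Fin m, ∑ c : V → Bool × Fin m,
        f (visited ind f (sample c) ∩ (sample c ∪ thinned c k)) := by
    simp [hperm]
  rw [h2, Finset.sum_comm, Finset.mul_sum]
  refine Finset.sum_le_sum fun c _ => ?_
  have := sum_union_ge hf (visited ind f (sample c) ∩ sample c)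
    (fun k => visited ind f (sample c) ∩ thinned c k) ?_ Finset.univ
  · simpa [Finset.inter_union_distrib_left] using this
  · intro i j hij
    refine Finset.disjoint_of_subset_left Finset.inter_subset_right
      (Finset.disjoint_of_subset_right Finset.inter_subset_right ?_)
    rw [Finset.disjoint_left]
    intro v hv hv'
    rw [mem_thinned] at hv hv'
    exact hij (by simpa [hv] using hv')

/-- The weights `W` of the greedy solution, `G` of the unspanned thinned elements, and the loss
`Λ`, of average value, combine to a fraction of the optimum. -/
lemma combine_bounds {α m W G Λ F O : ℝ} (hα : 1 ≤ α) (hm1 : 3 * α ≤ m) (hm2 : m < 3 * α + 1)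
    (hW : 0 ≤ W) (hF : 0 ≤ F) (hG : W ≤ (m + 1) * G) (hΛ : (m + 1) * Λ ≤ 2 * W + F)
    (hO : O ≤ 2 * (F + 3 * W)) :
    1 / (24 * α * (3 * α + 1)) * O ≤ F + 1 / α * G - Λ / m := by
  have hm : 0 < m := by linarith
  have hα0 : 0 < α := by linarith
  have h1 : 1 / α * G ≥ W / (α * (m + 1)) := by
    rw [ge_iff_le, div_le_iff₀ (by positivity)]
    calc W ≤ (m + 1) * G := hG
      _ = 1 / α * G * (α * (m + 1)) := by field_simp
  have h2 : Λ / m ≤ (2 * W + F) / (m * (m + 1)) := by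
    rw [div_le_div_iff₀ hm (by positivity)]
    nlinarith
  have h3 : 1 / (24 * α * (3 * α + 1)) * O ≤ 1 / (12 * α * (3 * α + 1)) * (F + 3 * W) := by
    calc _ ≤ 1 / (24 * α * (3 * α + 1)) * (2 * (F + 3 * W)) := by gcongr
      _ = _ := by field_simp; ring
  have h4 : 1 / (4 * α * (3 * α + 1)) ≤ 1 / (α * (m + 1)) - 2 / (m * (m + 1)) := by
    have : 1 / (α * (m + 1)) - 2 / (m * (m + 1)) = (m - 2 * α) / (α * m * (m + 1)) := by
      field_simp
    rw [this, div_le_div_iff₀ (by positivity) (by positivity)]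
    -- Expanding (m - 3α)(3α + 1 - m) ≥ 0 gives m (m + 1) ≤ (3α + 1)(2m - 3α), and 2m - 3α ≤ 4 (m -
    -- 2α) because m ≥ 3α.
    have h5 : m * (m + 1) ≤ 4 * (3 * α + 1) * (m - 2 * α) := by
      nlinarith [mul_nonneg (sub_nonneg.2 hm1) (sub_nonneg.2 hm2.le)]
    nlinarith
  have h6 : 1 / (12 * α * (3 * α + 1)) ≤ 1 - 1 / (m * (m + 1)) := by
    have a1 : 1 / (12 * α * (3 * α + 1)) ≤ 1 / 2 :=
      one_div_le_one_div_of_le (by norm_num) (by nlinarith)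
    have a2 : 1 / (m * (m + 1)) ≤ 1 / 2 :=
      one_div_le_one_div_of_le (by norm_num) (by nlinarith)
    linarith
  have h7 := mul_le_mul_of_nonneg_right h4 hW
  have h8 := mul_le_mul_of_nonneg_right h6 hF
  have e1 : 1 / (12 * α * (3 * α + 1)) * (F + 3 * W) =
      1 / (12 * α * (3 * α + 1)) * F + 1 / (4 * α * (3 * α + 1)) * W := by
    field_simp
    ring
  have e2 : (1 / (α * (m + 1)) - 2 / (m * (m + 1))) * W + (1 - 1 / (m * (m + 1))) * F =
      F + W / (α * (m + 1)) - (2 * W + F) / (m * (m + 1)) := by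
    field_simp
    ring
  linarith

variable {N : Matroid V}

theorem card_mul_le_sum_guarantee (hN : N.E = Set.univ)
    (hind : ∀ S : Finset V, ind S ↔ N.Indep (S : Set V)) (hf : IsNonnegSubmodular f) (k₀ : Fin m)
    {α : ℝ} (hα : 1 ≤ α) (hm1 : 3 * α ≤ m) (hm2 : m < 3 * α + 1) {O : Finset V}
    (hO : N.Indep (O : Set V)) :
    1 / (24 * α * (3 * α + 1)) * ((Fintype.card (V → Bool × Fin m) : ℝ) * f O) ≤
      ∑ c : V → Bool × Fin m, (f ∅ +
        1 / α * ∑ u ∈ unspanned ind f (sample c) (thinned c k₀) N, weight ind f (sample c) u -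
        ∑ u ∈ visited ind f (sample c) ∩ thinned c k₀,
          loss ind f (sample c) (thinned c k₀) u) := by
  classical
  set κ : ℝ := (Fintype.card (V → Bool × Fin m) : ℝ)
  have hm : (0 : ℝ) < m := by linarith
  set W := ∑ c : V → Bool × Fin m, ∑ u ∈ visited ind f (sample c) ∩ sample c,
    weight ind f (sample c) u with hWdef
  set G := ∑ c : V → Bool × Fin m, ∑ u ∈ unspanned ind f (sample c) (thinned c k₀) N,
    weight ind f (sample c) u with hGdef
  set Λ := ∑ c : V → Bool × Fin m, ∑ u ∈ visited ind f (sample c) ∩ sample c,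
    loss ind f (sample c) (thinned c k₀) u with hΛdef
  set lossOf : V → Finset V → Finset V → ℝ := fun u A B => gain f A u - gain f (A ∪ B) u
  set weightOf : V → Finset V → Finset V → ℝ := fun u A _ => gain f A u
  have hloss : ∀ (c : V → Bool × Fin m) u, loss ind f (sample c) (thinned c k₀) u =
      lossOf u (before ind f (sample c) u ∩ sample c)
        (before ind f (sample c) u ∩ thinned c k₀) := by
    intro c u
    simp only [loss, weight, Finset.inter_union_distrib_left, lossOf]
  have hweight : ∀ (c : V → Bool × Fin m) u, weight ind f (sample c) u =
      weightOf u (before ind f (sample c) u ∩ sample c)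
        (before ind f (sample c) u ∩ thinned c k₀) := fun c u => rfl
  have hΛm : m * ∑ c : V → Bool × Fin m, ∑ u ∈ visited ind f (sample c) ∩ thinned c k₀,
      loss ind f (sample c) (thinned c k₀) u = Λ := by
    simp only [hΛdef, hloss, sum_visited_sample, sum_visited_thinned]
  have hWm : m * ∑ c : V → Bool × Fin m, ∑ u ∈ visited ind f (sample c) ∩ thinned c k₀,
      weight ind f (sample c) u = W := by
    simp only [hWdef, hweight, sum_visited_sample, sum_visited_thinned]
  have hWc : ∑ c : V → Bool × Fin m, ∑ u ∈ visited ind f (sample c) \ sample c,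
      weight ind f (sample c) u = W := by
    simp only [hWdef, hweight, sum_visited_sample k₀, sum_visited_sdiff_sample k₀]
  have hWG : W ≤ (m + 1) * G := by
    -- Being unspanned by the earlier thinned elements is a property of the state of greedy, so
    -- colour exchange applies to this indicator too.
    have h1 : ∑ c : V → Bool × Fin m, ∑ u ∈ (visited ind f (sample c) ∩ sample c).filter
        (fun u => u ∉ N.closure ((before ind f (sample c) u ∩ thinned c k₀ : Finset V) : Set V)),
        weight ind f (sample c) u = m * G := by
      have hh := sum_visited_sample (ind := ind) (f := f) k₀
        fun u A B => if u ∉ N.closure (B : Set V) then gain f A u else 0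
      rw [← sum_visited_thinned] at hh
      rw [hGdef]
      simp only [← Finset.sum_filter] at hh
      exact hh
    have h2 : ∑ c : V → Bool × Fin m, ∑ u ∈ (visited ind f (sample c) ∩ sample c).filter
        (fun u => u ∈ N.closure ((before ind f (sample c) u ∩ thinned c k₀ : Finset V) : Set V)),
        weight ind f (sample c) u ≤ G :=
      Finset.sum_le_sum fun c _ => sum_spanned_le hN hind hf
    calc W = ∑ c : V → Bool × Fin m, _ := Finset.sum_congr rfl fun c _ =>
          (Finset.sum_filter_add_sum_filter_not _ (fun u => u ∈ N.closure
            ((before ind f (sample c) u ∩ thinned c k₀ : Finset V) : Set V)) _).symm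
      _ ≤ (m + 1) * G := by
        rw [Finset.sum_add_distrib, h1]
        linarith
  have hWf : W = ∑ c : V → Bool × Fin m, f (visited ind f (sample c) ∩ sample c) - κ * f ∅ := by
    rw [hWdef]
    simp only [sum_weight, Finset.sum_sub_distrib]
    simp [κ]
  -- Telescoping along sample and thinned set; by colour exchange the thinned part is 1/m of the
  -- sample part.
  have hUf : W - Λ + (W - Λ) / m = ∑ c : V → Bool × Fin m,
      f (visited ind f (sample c) ∩ (sample c ∪ thinned c k₀)) - κ * f ∅ := by
    have h1 : ∀ c : V → Bool × Fin m,
        f (visited ind f (sample c) ∩ (sample c ∪ thinned c k₀)) - f ∅ =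
        ∑ u ∈ visited ind f (sample c) ∩ sample c,
          (weight ind f (sample c) u - loss ind f (sample c) (thinned c k₀) u) +
        ∑ u ∈ visited ind f (sample c) ∩ thinned c k₀,
          (weight ind f (sample c) u - loss ind f (sample c) (thinned c k₀) u) := by
      intro c
      rw [← sum_weight_sub_loss, Finset.inter_union_distrib_left, Finset.sum_union]
      refine Finset.disjoint_of_subset_left Finset.inter_subset_right
        (Finset.disjoint_of_subset_right Finset.inter_subset_right ?_)
      rw [Finset.disjoint_left]
      intro v hv hv'
      rw [mem_sample] at hv
      rw [mem_thinned] at hv'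
      simp [hv'] at hv
    have h2 : ∑ c : V → Bool × Fin m,
        (f (visited ind f (sample c) ∩ (sample c ∪ thinned c k₀)) - f ∅) =
        ∑ c : V → Bool × Fin m,
          f (visited ind f (sample c) ∩ (sample c ∪ thinned c k₀)) - κ * f ∅ := by
      rw [Finset.sum_sub_distrib]
      simp [κ]
    rw [← h2]
    simp only [h1, Finset.sum_add_distrib, Finset.sum_sub_distrib]
    rw [← hWdef, ← hΛdef]
    congr 1
    rw [div_eq_iff hm.ne', ← hWm, ← hΛm]
    ring
  have hsym := sum_sample_le_sum_union (ind := ind) hf k₀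
  -- With F = `κ * f ∅`, the symmetry bound reads (m - 1)(W + F) ≤ (m + 1)(W - Λ) + m F.
  have hΛ : (m + 1) * Λ ≤ 2 * W + κ * f ∅ := by
    rw [eq_sub_iff_add_eq] at hWf hUf
    rw [← hWf, ← hUf] at hsym
    have : (m : ℝ) * (W - Λ + (W - Λ) / m + κ * f ∅) =
        (m + 1) * (W - Λ) + m * (κ * f ∅) := by
      field_simp
    nlinarith
  have hOW : κ * f O ≤ 2 * (κ * f ∅ + 3 * W) := by
    refine (card_mul_le_sum_union (ind := ind) (m := m) hf O).trans ?_
    have h1 : ∑ c : V → Bool × Fin m, f (O ∪ visited ind f (sample c) ∩ sample c) ≤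
        ∑ c : V → Bool × Fin m, (f ∅ + 2 * ∑ u ∈ visited ind f (sample c) ∩ sample c,
          weight ind f (sample c) u + ∑ u ∈ visited ind f (sample c) \ sample c,
          weight ind f (sample c) u) :=
      Finset.sum_le_sum fun c _ => value_union_le hN hind hf hO
    rw [Finset.sum_add_distrib, Finset.sum_add_distrib, ← Finset.mul_sum, hWc, ← hWdef] at h1
    simp only [Finset.sum_const, Finset.card_univ, nsmul_eq_mul] at h1
    linarith
  have hW0 : 0 ≤ W := Finset.sum_nonneg fun c _ => Finset.sum_nonneg fun u hu =>
    (weight_pos (Finset.mem_inter.1 hu).1).le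
  have hF0 : 0 ≤ κ * f ∅ := mul_nonneg (Nat.cast_nonneg _) (hf.nonneg _)
  refine (combine_bounds hα hm1 hm2 hW0 hF0 hWG hΛ hOW).trans (le_of_eq ?_)
  rw [Finset.sum_sub_distrib, Finset.sum_add_distrib, ← Finset.mul_sum, ← hGdef, ← hΛm,
    mul_div_cancel_left₀ _ hm.ne']
  simp [κ]

end Colorings

end SimulatedGreedy

namespace SimulatedGreedy

/-! ### Weights computed from the sample and one further element. -/

section RankWeight

variable {V : Type u} [LinearOrder V] [Fintype V] {m : ℕ} {ind : Finset V → Prop}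
  {f : Finset V → ℝ}

variable (ind f) in
/-- The weight of `u` in the simulated instance of the linear problem: the marginal value with which
greedy, run on the sample together with `u`, considers `u`, if `u` has the colour `(false, k₀)`. -/
noncomputable def rankWeight (k₀ : Fin m) (c : V → Bool × Fin m) (u : V) : ℝ :=
  if c u = (false, k₀) then
    visitSum (run ind f (sample c) (insert u (sample c)) ∅) u fun D => gain f (D ∩ sample c) u
  else 0

lemma rankWeight_eq (k₀ : Fin m) (c : V → Bool × Fin m) (u : V) :
    rankWeight ind f k₀ c u =
      if u ∈ visited ind f (sample c) ∩ thinned c k₀ then weight ind f (sample c) u else 0 := by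
  rw [rankWeight, visitSum_run_restrict (R := ∅ᶜ) (C := ∅) (fun D => gain f D u) (by simp)
    (fun v _ hv => Finset.mem_insert_of_mem hv) rfl (Finset.mem_insert_self _ _), visitSum_run]
  simp only [Finset.mem_inter, mem_thinned, weight]
  split_ifs <;> simp_all

lemma rankWeight_nonneg (k₀ : Fin m) (c : V → Bool × Fin m) (u : V) :
    0 ≤ rankWeight ind f k₀ c u := by
  rw [rankWeight_eq]
  split_ifs with h
  · exact (weight_pos (Finset.mem_inter.1 h).1).le
  · exact le_rfl

lemma mem_of_rankWeight_pos {k₀ : Fin m} {c : V → Bool × Fin m} {u : V}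
    (h : 0 < rankWeight ind f k₀ c u) : u ∈ visited ind f (sample c) ∩ thinned c k₀ := by
  by_contra hu
  rw [rankWeight_eq, if_neg hu] at h
  exact lt_irrefl _ h

lemma rankWeight_congr {ind' : Finset V → Prop} {f' : Finset V → ℝ} (k₀ : Fin m)
    (c : V → Bool × Fin m) (u : V)
    (h : c u = (false, k₀) → ∀ S ⊆ insert u (sample c), (ind S ↔ ind' S) ∧ f S = f' S) :
    rankWeight ind f k₀ c u = rankWeight ind' f' k₀ c u := by
  unfold rankWeight
  split_ifs with hc
  · rw [run_congr (fun S hS => (h hc S hS).1) (fun S hS => (h hc S hS).2) subset_rfl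
      (Finset.subset_insert _ _)]
    congr 1
    ext D
    have h1 : D ∩ sample c ⊆ insert u (sample c) :=
      Finset.inter_subset_right.trans (Finset.subset_insert _ _)
    rw [gain, gain, (h hc _ h1).2,
      (h hc _ (Finset.insert_subset (Finset.mem_insert_self _ _) h1)).2]
  · rfl

end RankWeight

/-! ### Moving a set of positions to the front. -/

section RevealOrder

variable {n : ℕ}

/-- The elements of `P` first, then the others, both in their given order. -/
def revealKey (P : Finset (Fin n)) (i : Fin n) : ℕ := if i ∈ P then i else n + i

/-- The permutation that moves the elements of `P` to the front. -/
def revealOrder (P : Finset (Fin n)) : Equiv.Perm (Fin n) := (Tuple.sort (revealKey P)).symm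

lemma revealKey_injective (P : Finset (Fin n)) : Function.Injective (revealKey P) := by
  intro i j h
  unfold revealKey at h
  have := i.isLt
  have := j.isLt
  ext
  split_ifs at h <;> omega

lemma revealOrder_le {P : Finset (Fin n)} {i j : Fin n} (h : revealKey P i ≤ revealKey P j) :
    revealOrder P i ≤ revealOrder P j := by
  have hs : StrictMono (revealKey P ∘ Tuple.sort (revealKey P)) :=
    (Tuple.monotone_sort _).strictMono_of_injective
      ((revealKey_injective P).comp (Equiv.injective _))
  rw [← hs.le_iff_le]
  simpa [revealOrder] using h

lemma revealOrder_le_of_mem {P : Finset (Fin n)} {i j : Fin n} (hi : i ∈ P) (hj : j ∉ P) :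
    revealOrder P i ≤ revealOrder P j := by
  refine revealOrder_le ?_
  rw [revealKey, revealKey, if_pos hi, if_neg hj]
  omega

lemma revealOrder_le_of_le {P : Finset (Fin n)} {i j : Fin n} (hij : i ≤ j) (hj : j ∉ P) :
    revealOrder P i ≤ revealOrder P j := by
  by_cases hi : i ∈ P
  · exact revealOrder_le_of_mem hi hj
  · refine revealOrder_le ?_
    rw [revealKey, revealKey, if_neg hi, if_neg hj]
    have : (i : ℕ) ≤ j := hij
    omega

end RevealOrder

/-! ### The online algorithm. -/

section Simulation

variable {Λ : Type w} {m n : ℕ} (k₀ : Fin m) (c : Fin n → Bool × Fin m) (ρ : Equiv.Perm (Fin n))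

/-- The arrival times of the elements, listed in the simulated order. -/
def simulatedOrder : Equiv.Perm (Fin n) :=
  revealOrder (Finset.univ.filter fun i => ρ i ∈ sample c)

/-- The arrival times of the elements, listed by rank. -/
def rankOrder : Equiv.Perm (Fin n) := ρ.symm.trans (simulatedOrder c ρ)

/-- The weights of the elements in the simulated order. -/
noncomputable def simulatedWeight (I : OrderedInput Λ n) (i : Fin n) : ℝ :=
  rankWeight (fun S => I.indep (S.map (rankOrder c ρ).toEmbedding))
    (fun S => I.value (S.map (rankOrder c ρ).toEmbedding)) k₀ c (ρ i)

/-- The simulated instance of the linear problem. -/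
noncomputable def simulatedInput (I : OrderedInput Λ n) : OrderedInput Λ n where
  label i := I.label (simulatedOrder c ρ i)
  indep S := I.indep (S.map (simulatedOrder c ρ).toEmbedding)
  value S := ∑ i ∈ S, simulatedWeight k₀ c ρ I i

/-- The arrival times of the elements of a set in the simulated order that have positive weight. -/
noncomputable def realAccept (I : OrderedInput Λ n) (T : Finset (Fin n)) : Finset (Fin n) :=
  (T.filter fun i => 0 < simulatedWeight k₀ c ρ I i).map (simulatedOrder c ρ).toEmbedding

variable {k₀ c ρ} {I J : OrderedInput Λ n} {i j : Fin n}

/-- Sample positions take the earliest arrival times and the other positions keep their order. So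
when a thinned element arrives, the whole sample and everything before it in the simulated order
have arrived, which makes the simulation online. -/
lemma simulatedOrder_le (hi : c (ρ i) = (false, k₀)) (hj : j ≤ i ∨ ρ j ∈ sample c) :
    simulatedOrder c ρ j ≤ simulatedOrder c ρ i := by
  have hi' : i ∉ Finset.univ.filter fun i => ρ i ∈ sample c := by simp [hi]
  rcases hj with h | h
  · exact revealOrder_le_of_le h hi'
  · exact revealOrder_le_of_mem (by simpa using h) hi'

lemma simulatedWeight_congr (hi : c (ρ i) = (false, k₀))
    (h : I.AgreeUpTo (simulatedOrder c ρ i) J) (hj : j ≤ i) :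
    simulatedWeight k₀ c ρ I j = simulatedWeight k₀ c ρ J j := by
  refine rankWeight_congr _ _ _ fun _ S hS => h.2 _ fun x hx => ?_
  obtain ⟨u, hu, rfl⟩ := Finset.mem_map.1 hx
  simp only [Equiv.coe_toEmbedding, rankOrder, Equiv.trans_apply]
  refine simulatedOrder_le hi ?_
  rcases Finset.mem_insert.1 (hS hu) with rfl | hu
  · exact Or.inl (by simpa using hj)
  · exact Or.inr (by simpa using hu)

lemma simulatedInput_agreeUpTo (hi : c (ρ i) = (false, k₀))
    (h : I.AgreeUpTo (simulatedOrder c ρ i) J) :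
    (simulatedInput k₀ c ρ I).AgreeUpTo i (simulatedInput k₀ c ρ J) := by
  refine ⟨fun j hj => h.1 _ (simulatedOrder_le hi (Or.inl hj)), fun S hS => ⟨?_, ?_⟩⟩
  · refine (h.2 _ fun x hx => ?_).1
    obtain ⟨j, hj, rfl⟩ := Finset.mem_map.1 hx
    exact simulatedOrder_le hi (Or.inl (hS j hj))
  · exact Finset.sum_congr rfl fun j hj => simulatedWeight_congr hi h (hS j hj)

lemma eq_of_simulatedWeight_pos (h : 0 < simulatedWeight k₀ c ρ I i) : c (ρ i) = (false, k₀) := by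
  simpa using (Finset.mem_inter.1 (mem_of_rankWeight_pos h)).2

lemma mem_realAccept {T : Finset (Fin n)} : simulatedOrder c ρ i ∈ realAccept k₀ c ρ I T ↔
    i ∈ T ∧ 0 < simulatedWeight k₀ c ρ I i := by
  simp [realAccept]

/-- The random choices of the simulation: the colours of the ranks, and the ranks of the elements in
the simulated order. -/
def Coins (m n : ℕ) : Type v := ULift.{v} ((Fin n → Bool × Fin m) × Equiv.Perm (Fin n))

instance : MeasurableSpace (Coins.{v} m n) := ⊤

instance : DiscreteMeasurableSpace (Coins.{v} m n) := ⟨fun _ => trivial⟩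

noncomputable instance : Fintype (Coins.{v} m n) :=
  inferInstanceAs (Fintype (ULift ((Fin n → Bool × Fin m) × Equiv.Perm (Fin n))))

instance [NeZero m] : Nonempty (Coins.{v} m n) :=
  inferInstanceAs (Nonempty (ULift ((Fin n → Bool × Fin m) × Equiv.Perm (Fin n))))

/-- The online algorithm for submodular objectives obtained from one for linear objectives. -/
noncomputable def simulation (A : OnlineAlgorithm.{v, w} Λ) (m : ℕ) [NeZero m] :
    OnlineAlgorithm.{v, w} Λ where
  Seed n := A.Seed n × Coins.{v} m n
  prob n := (A.prob n).prod (PMF.uniformOfFintype (Coins.{v} m n)).toMeasure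
  accept n s I := realAccept 0 s.2.down.1 s.2.down.2 I
    (A.accept n s.1 (simulatedInput 0 s.2.down.1 s.2.down.2 I))
  online n s t I J h := by
    obtain ⟨i, rfl⟩ := (simulatedOrder s.2.down.1 s.2.down.2).surjective t
    rw [mem_realAccept, mem_realAccept]
    -- Only thinned elements need the oracle answers at their arrival; any other element has weight
    -- zero and is rejected whatever the input.
    by_cases hi : s.2.down.1 (s.2.down.2 i) = (false, 0)
    · rw [simulatedWeight_congr hi h le_rfl,
        A.online n s.1 i _ _ (simulatedInput_agreeUpTo hi h)]
    · exact iff_of_false (fun h => hi (eq_of_simulatedWeight_pos h.2))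
        (fun h => hi (eq_of_simulatedWeight_pos h.2))
  measurable_accept n I T := by
    have : {s : A.Seed n × Coins.{v} m n | realAccept 0 s.2.down.1 s.2.down.2 I
        (A.accept n s.1 (simulatedInput 0 s.2.down.1 s.2.down.2 I)) = T} =
        ⋃ d : Coins.{v} m n, ⋃ T' : Finset (Fin n), ⋃ _ : realAccept 0 d.down.1 d.down.2 I T' = T,
          {s | A.accept n s (simulatedInput 0 d.down.1 d.down.2 I) = T'} ×ˢ {d} := by
      ext s
      simp
    rw [this]
    exact MeasurableSet.iUnion fun d => MeasurableSet.iUnion fun T' => MeasurableSet.iUnion fun _ =>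
      (A.measurable_accept n _ T').prod (MeasurableSet.of_discrete)

end Simulation

end SimulatedGreedy

/-! ### Measurability and integrability of functions of the accepted set. -/

namespace OnlineAlgorithm

variable {Λ : Type w}

lemma measurable_comp_accept (A : OnlineAlgorithm.{v, w} Λ) {n : ℕ} (I : OrderedInput Λ n)
    (g : Finset (Fin n) → ℝ) : Measurable fun s => g (A.accept n s I) := by
  intro B _
  have : (fun s => g (A.accept n s I)) ⁻¹' B =
      ⋃ T : Finset (Fin n), ⋃ _ : g T ∈ B, {s | A.accept n s I = T} := by
    ext s
    simp
  rw [this]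
  exact MeasurableSet.iUnion fun T => MeasurableSet.iUnion fun _ => A.measurable_accept n I T

lemma integrable_comp_accept (A : OnlineAlgorithm.{v, w} Λ) {n : ℕ} (I : OrderedInput Λ n)
    (g : Finset (Fin n) → ℝ) : Integrable (fun s => g (A.accept n s I)) (A.prob n) := by
  refine Integrable.of_bound (A.measurable_comp_accept I g).aestronglyMeasurable
    (∑ T, ‖g T‖) (Eventually.of_forall fun s => ?_)
  exact Finset.single_le_sum (f := fun T => ‖g T‖) (fun T _ => norm_nonneg _) (Finset.mem_univ _)

end OnlineAlgorithm

namespace SimulatedGreedy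

section Instance

/-! ### From colourings to the expected value on an instance. -/

variable {Λ : Type w} {E : Type u} [Fintype E] {m : ℕ} {M : Matroid E} {f : Finset E → ℝ}

omit [Fintype E] in
lemma isNonnegSubmodular_comp_map {V : Type*} (hf : IsNonnegSubmodular f) (θ : V ≃ E) :
    IsNonnegSubmodular fun S : Finset V => f (S.map θ.toEmbedding) where
  nonneg S := hf.nonneg _
  diminishing := by
    classical
    intro _ A B e h he
    have := hf.diminishing (A.map θ.toEmbedding) (B.map θ.toEmbedding) (θ e)
      (Finset.map_subset_map.2 h) (by simpa using he)
    simp only [Finset.map_insert]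
    exact this

variable (M f) in
/-- The weights of the simulated linear problem, given the colours of the ranks and the element of
each rank. -/
noncomputable def elementWeight (k₀ : Fin m) (c : Fin (Fintype.card E) → Bool × Fin m)
    (θ : Fin (Fintype.card E) ≃ E) (e : E) : ℝ :=
  rankWeight (fun S => M.Indep (S.map θ.toEmbedding : Finset E))
    (fun S => f (S.map θ.toEmbedding)) k₀ c (θ.symm e)

lemma elementWeight_nonneg (k₀ : Fin m) (c : Fin (Fintype.card E) → Bool × Fin m)
    (θ : Fin (Fintype.card E) ≃ E) (e : E) : 0 ≤ elementWeight M f k₀ c θ e :=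
  rankWeight_nonneg _ _ _

variable (k₀ : Fin m) (c : Fin (Fintype.card E) → Bool × Fin m)
  (ρ : Equiv.Perm (Fin (Fintype.card E))) (π : Fin (Fintype.card E) ≃ E) (lab : E → Λ)

lemma simulatedWeight_orderedInput (i : Fin (Fintype.card E)) :
    simulatedWeight k₀ c ρ (orderedInput M lab f π) i =
      elementWeight M f k₀ c (ρ.symm.trans ((simulatedOrder c ρ).trans π))
        ((simulatedOrder c ρ).trans π i) := by
  simp only [simulatedWeight, elementWeight, orderedInput, Finset.map_map]
  congr 1
  simp

lemma simulatedInput_orderedInput :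
    simulatedInput k₀ c ρ (orderedInput M lab f π) =
      orderedInput M lab
        (linearValue (elementWeight M f k₀ c (ρ.symm.trans ((simulatedOrder c ρ).trans π))))
        ((simulatedOrder c ρ).trans π) := by
  simp only [simulatedInput, simulatedWeight_orderedInput]
  simp only [orderedInput, OrderedInput.mk.injEq, Finset.map_map, linearValue, Finset.sum_map]
  exact ⟨rfl, rfl, rfl⟩

lemma map_realAccept (T : Finset (Fin (Fintype.card E))) :
    (realAccept k₀ c ρ (orderedInput M lab f π) T).map π.toEmbedding =
      (T.map ((simulatedOrder c ρ).trans π).toEmbedding).filter fun e =>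
        0 < elementWeight M f k₀ c (ρ.symm.trans ((simulatedOrder c ρ).trans π)) e := by
  rw [realAccept, Finset.map_map, Finset.filter_map]
  simp only [simulatedWeight_orderedInput]
  rfl

variable (A : OnlineAlgorithm.{v, w} Λ)

lemma output_simulation [NeZero m] (s : A.Seed (Fintype.card E))
    (d : Coins.{v} m (Fintype.card E)) :
    (simulation A m).output M lab f π (s, d) =
      (A.output M lab (linearValue (elementWeight M f 0 d.down.1
          (d.down.2.symm.trans ((simulatedOrder d.down.1 d.down.2).trans π))))
        ((simulatedOrder d.down.1 d.down.2).trans π) s).filter fun e =>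
        0 < elementWeight M f 0 d.down.1
          (d.down.2.symm.trans ((simulatedOrder d.down.1 d.down.2).trans π)) e := by
  refine (map_realAccept 0 d.down.1 d.down.2 π lab _).trans ?_
  rw [simulatedInput_orderedInput]
  rfl

lemma isSMSPAlgorithm_simulation [NeZero m] (hA : A.IsMSPAlgorithm.{u, v, w}) :
    (simulation A m).IsSMSPAlgorithm.{u, v, w} := by
  rintro E _ M lab f hM _ π ⟨s, d⟩
  rw [output_simulation]
  have := hA E M lab _ hM (elementWeight_nonneg (M := M) (f := f) (0 : Fin m) d.down.1
    (d.down.2.symm.trans ((simulatedOrder d.down.1 d.down.2).trans π)))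
    ((simulatedOrder d.down.1 d.down.2).trans π) s
  exact this.subset (Finset.coe_subset.2 (Finset.filter_subset _ _))

lemma integral_simulation {m n : ℕ} [NeZero m] (I : OrderedInput Λ n) (g : Finset (Fin n) → ℝ) :
    ∫ s, g ((simulation A m).accept n s I) ∂(simulation A m).prob n =
      (Fintype.card (Coins.{v} m n) : ℝ)⁻¹ * ∑ d : Coins.{v} m n,
        ∫ s, g ((simulation A m).accept n (s, d) I) ∂A.prob n := by
  have h1 := (simulation A m).integrable_comp_accept I g
  refine (integral_prod_symm _ h1).trans ?_
  rw [PMF.integral_eq_sum, Finset.mul_sum]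
  simp

omit [Fintype E] in
/-- Two independent uniformly random bijections, in two parametrizations. -/
lemma sum_trans_eq {V : Type*} [Fintype (Equiv.Perm V)] [Fintype (V ≃ E)]
    (Φ : (V ≃ E) → (V ≃ E) → ℝ) (τ : Equiv.Perm V → Equiv.Perm V) :
    ∑ π : V ≃ E, ∑ ρ : Equiv.Perm V, Φ (ρ.symm.trans ((τ ρ).trans π)) ((τ ρ).trans π) =
      ∑ θ : V ≃ E, ∑ σ : V ≃ E, Φ θ σ := by
  -- For fixed `ρ` the simulated order σ = `(τ ρ).trans π` is uniform, however `τ` depends on `ρ`;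
  -- for fixed σ the rank bijection is then uniform in `ρ`.
  have h1 : ∀ ρ : Equiv.Perm V, ∑ π : V ≃ E, Φ (ρ.symm.trans ((τ ρ).trans π)) ((τ ρ).trans π) =
      ∑ σ : V ≃ E, Φ (ρ.symm.trans σ) σ := fun ρ =>
    Equiv.sum_comp ((τ ρ).symm.equivCongr (Equiv.refl E)) fun σ => Φ (ρ.symm.trans σ) σ
  have h2 : ∀ σ : V ≃ E, ∑ ρ : Equiv.Perm V, Φ (ρ.symm.trans σ) σ = ∑ θ : V ≃ E, Φ θ σ := by
    intro σ
    let e : Equiv.Perm V ≃ (V ≃ E) :=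
      { toFun := fun ρ => ρ.symm.trans σ
        invFun := fun θ => σ.trans θ.symm
        left_inv := fun ρ => by ext; simp
        right_inv := fun θ => by ext; simp }
    exact Equiv.sum_comp e fun θ => Φ θ σ
  rw [Finset.sum_comm, Finset.sum_congr rfl fun ρ _ => h1 ρ, Finset.sum_comm,
    Finset.sum_congr rfl fun σ _ => h2 σ, Finset.sum_comm]

open Classical in
/-- The expected value of the accepted set, as an average over the simulated order, the ranks
and the colours. -/
lemma expectedValue_simulation [NeZero m] :
    (simulation A m).expectedValue M lab f =
      (1 / (Fintype.card (Fin (Fintype.card E) ≃ E) : ℝ)) *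
        ((Fintype.card (Coins.{v} m (Fintype.card E)) : ℝ)⁻¹ *
          ∑ θ : Fin (Fintype.card E) ≃ E, ∑ c : Fin (Fintype.card E) → Bool × Fin m,
            ∑ σ : Fin (Fintype.card E) ≃ E,
              ∫ s, f ((A.output M lab (linearValue (elementWeight M f 0 c θ)) σ s).filter
                fun e => 0 < elementWeight M f 0 c θ e) ∂A.prob (Fintype.card E)) := by
  set Φ : (Fin (Fintype.card E) → Bool × Fin m) → (Fin (Fintype.card E) ≃ E) →
      (Fin (Fintype.card E) ≃ E) → ℝ := fun c θ σ =>
    ∫ s, f ((A.output M lab (linearValue (elementWeight M f 0 c θ)) σ s).filter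
      fun e => 0 < elementWeight M f 0 c θ e) ∂A.prob (Fintype.card E)
  have h1 : ∀ π : Fin (Fintype.card E) ≃ E,
      ∫ s, f ((simulation A m).output M lab f π s) ∂(simulation A m).prob (Fintype.card E) =
      (Fintype.card (Coins.{v} m (Fintype.card E)) : ℝ)⁻¹ *
        ∑ c, ∑ ρ : Equiv.Perm (Fin (Fintype.card E)),
          Φ c (ρ.symm.trans ((simulatedOrder c ρ).trans π)) ((simulatedOrder c ρ).trans π) := by
    intro π
    refine (integral_simulation A (orderedInput M lab f π)
      fun T => f (T.map π.toEmbedding)).trans ?_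
    rw [← Fintype.sum_prod_type']
    congr 1
    refine Fintype.sum_equiv Equiv.ulift _ _ fun d => ?_
    refine integral_congr_ae (Eventually.of_forall fun s => ?_)
    exact congrArg f (output_simulation π lab A s d)
  have h2 : ∀ c, ∑ π : Fin (Fintype.card E) ≃ E, ∑ ρ : Equiv.Perm (Fin (Fintype.card E)),
      Φ c (ρ.symm.trans ((simulatedOrder c ρ).trans π)) ((simulatedOrder c ρ).trans π) =
      ∑ θ, ∑ σ, Φ c θ σ := by
    intro c
    exact sum_trans_eq (fun θ σ => Φ c θ σ) (simulatedOrder c)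
  rw [OnlineAlgorithm.expectedValue]
  simp only [h1]
  rw [← Finset.mul_sum, Finset.sum_comm]
  simp only [h2]
  rw [Finset.sum_comm]

variable {A k₀ c lab}

open Classical in
/-- The expected value for fixed ranks and colours, by the guarantee for the linear problem. -/
lemma guarantee_le_sum_integral (hf : IsNonnegSubmodular f) {α : ℝ}
    (hA : A.MSPCompetitive M lab α) (θ : Fin (Fintype.card E) ≃ E)
    {N : Matroid (Fin (Fintype.card E))} (hN : N.E = Set.univ)
    (hind : ∀ S : Finset (Fin (Fintype.card E)),
      M.Indep (S.map θ.toEmbedding : Finset E) ↔ N.Indep (S : Set (Fin (Fintype.card E)))) :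
    (Fintype.card (Fin (Fintype.card E) ≃ E) : ℝ) *
      (f ((∅ : Finset (Fin (Fintype.card E))).map θ.toEmbedding) +
        1 / α * ∑ u ∈ unspanned (fun S => M.Indep (S.map θ.toEmbedding : Finset E))
            (fun S => f (S.map θ.toEmbedding)) (sample c) (thinned c k₀) N,
          weight (fun S => M.Indep (S.map θ.toEmbedding : Finset E))
            (fun S => f (S.map θ.toEmbedding)) (sample c) u -
        ∑ u ∈ visited (fun S => M.Indep (S.map θ.toEmbedding : Finset E))
            (fun S => f (S.map θ.toEmbedding)) (sample c) ∩ thinned c k₀,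
          loss (fun S => M.Indep (S.map θ.toEmbedding : Finset E))
            (fun S => f (S.map θ.toEmbedding)) (sample c) (thinned c k₀) u) ≤
      ∑ σ : Fin (Fintype.card E) ≃ E,
        ∫ s, f ((A.output M lab (linearValue (elementWeight M f k₀ c θ)) σ s).filter
          fun e => 0 < elementWeight M f k₀ c θ e) ∂A.prob (Fintype.card E) := by
  set ind' : Finset (Fin (Fintype.card E)) → Prop := fun S =>
    M.Indep (S.map θ.toEmbedding : Finset E) with hind'
  set f' : Finset (Fin (Fintype.card E)) → ℝ := fun S => f (S.map θ.toEmbedding) with hf'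
  set wt := elementWeight M f k₀ c θ with hwt
  set loss' := ∑ u ∈ visited ind' f' (sample c) ∩ thinned c k₀,
    loss ind' f' (sample c) (thinned c k₀) u
  have hsub : IsNonnegSubmodular f' := isNonnegSubmodular_comp_map hf θ
  have hwt_map : ∀ u, wt (θ u) = rankWeight ind' f' k₀ c u := fun u => by
    rw [hwt, elementWeight, Equiv.symm_apply_apply]
  have hmem : ∀ u, 0 < wt (θ u) → u ∈ visited ind' f' (sample c) ∩ thinned c k₀ := fun u hu =>
    mem_of_rankWeight_pos (hwt_map u ▸ hu)
  have hval : ∀ u ∈ visited ind' f' (sample c) ∩ thinned c k₀,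
      wt (θ u) = weight ind' f' (sample c) u := fun u hu => by
    rw [hwt_map, rankWeight_eq, if_pos hu]
  -- Discarding elements of weight zero keeps the linear value and leaves only considered thinned
  -- elements, to which `le_value_of_subset` applies.
  have hpoint : ∀ X : Finset E,
      f' ∅ + linearValue wt X - loss' ≤ f (X.filter fun e => 0 < wt e) := by
    intro X
    set Q := (X.filter fun e => 0 < wt e).map θ.symm.toEmbedding with hQ
    have hmap : Q.map θ.toEmbedding = X.filter fun e => 0 < wt e := by
      ext e
      simp [hQ]
    have hQsub : Q ⊆ visited ind' f' (sample c) ∩ thinned c k₀ := by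
      intro u hu
      have : θ u ∈ Q.map θ.toEmbedding := by simpa using hu
      rw [hmap, Finset.mem_filter] at this
      exact hmem u this.2
    have h1 := le_value_of_subset hsub hQsub
    have h2 : ∑ u ∈ Q, weight ind' f' (sample c) u = linearValue wt X := by
      rw [← Finset.sum_congr rfl fun u hu => hval u (hQsub hu)]
      refine (Finset.sum_map Q θ.toEmbedding wt).symm.trans ?_
      rw [hmap]
      exact Finset.sum_filter_of_ne fun e _ he =>
        lt_of_le_of_ne (elementWeight_nonneg _ _ _ _) he.symm
    rw [h2] at h1
    refine h1.trans (le_of_eq ?_)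
    exact congrArg f hmap
  -- The unspanned elements serve as the independent benchmark for the linear problem.
  have hcomp := hA wt (elementWeight_nonneg _ _ _)
    ((unspanned ind' f' (sample c) (thinned c k₀) N).map θ.toEmbedding)
    ((hind _).2 (indep_unspanned hN))
  have hun : linearValue wt ((unspanned ind' f' (sample c) (thinned c k₀) N).map θ.toEmbedding) =
      ∑ u ∈ unspanned ind' f' (sample c) (thinned c k₀) N, weight ind' f' (sample c) u := by
    rw [linearValue, Finset.sum_map]
    refine Finset.sum_congr rfl fun u hu => hval u ?_
    exact Finset.mem_inter.2 (mem_unspanned.1 hu).1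
  rw [hun, OnlineAlgorithm.expectedValue] at hcomp
  have hcard : (0 : ℝ) < Fintype.card (Fin (Fintype.card E) ≃ E) := by
    exact_mod_cast Fintype.card_pos_iff.2 ⟨θ⟩
  rw [one_div_mul_eq_div, one_div_mul_eq_div, le_div_iff₀ hcard] at hcomp
  have hint : ∀ (σ : Fin (Fintype.card E) ≃ E) (g : Finset E → ℝ), Integrable
      (fun s => g (A.output M lab (linearValue wt) σ s)) (A.prob (Fintype.card E)) := fun σ g =>
    A.integrable_comp_accept (orderedInput M lab (linearValue wt) σ)
      fun T => g (T.map σ.toEmbedding)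
  have hσ : ∀ σ : Fin (Fintype.card E) ≃ E,
      f' ∅ - loss' + ∫ s, linearValue wt (A.output M lab (linearValue wt) σ s)
        ∂A.prob (Fintype.card E) ≤
      ∫ s, f ((A.output M lab (linearValue wt) σ s).filter fun e => 0 < wt e)
        ∂A.prob (Fintype.card E) := by
    intro σ
    have h1 : ∫ s, (f' ∅ - loss' + linearValue wt (A.output M lab (linearValue wt) σ s))
        ∂A.prob (Fintype.card E) = f' ∅ - loss' +
        ∫ s, linearValue wt (A.output M lab (linearValue wt) σ s) ∂A.prob (Fintype.card E) := by
      rw [integral_add (integrable_const _) (hint σ _)]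
      simp
    rw [← h1]
    refine integral_mono ((integrable_const _).add (hint σ _))
      (hint σ fun X => f (X.filter fun e => 0 < wt e)) fun s => ?_
    have := hpoint (A.output M lab (linearValue wt) σ s)
    dsimp only
    linarith
  have hsum := Finset.sum_le_sum fun σ (_ : σ ∈ Finset.univ) => hσ σ
  rw [Finset.sum_add_distrib] at hsum
  simp only [Finset.sum_const, Finset.card_univ, nsmul_eq_mul] at hsum
  refine le_trans (le_of_eq_of_le ?_ (add_le_add le_rfl hcomp)) hsum
  simp only [hf']
  ring

open Classical in
theorem sMSPCompetitive_simulation [NeZero m] (hM : M.E = Set.univ) {α : ℝ} (hα : 1 ≤ α)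
    (hm1 : 3 * α ≤ m) (hm2 : m < 3 * α + 1) (hA : A.MSPCompetitive M lab α) :
    (simulation A m).SMSPCompetitive M lab (24 * α * (3 * α + 1)) := by
  intro f hf S hS
  rw [expectedValue_simulation]
  set p : ℝ := ((Fintype.card (Fin (Fintype.card E) ≃ E) : ℕ) : ℝ) with hp
  set κ : ℝ := ((Fintype.card (Fin (Fintype.card E) → Bool × Fin m) : ℕ) : ℝ) with hκ
  have hp0 : 0 < p := by
    exact Nat.cast_pos.2 (Fintype.card_pos_iff.2 ⟨(Fintype.equivFin E).symm⟩)
  have hκ0 : 0 < κ := by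
    exact Nat.cast_pos.2 (Fintype.card_pos_iff.2 inferInstance)
  have hcoins : (Fintype.card (Coins.{v} m (Fintype.card E)) : ℝ) = κ * p := by
    have h1 : Fintype.card (Coins.{v} m (Fintype.card E)) =
        Fintype.card (Fin (Fintype.card E) → Bool × Fin m) *
          Fintype.card (Equiv.Perm (Fin (Fintype.card E))) :=
      (Fintype.card_congr Equiv.ulift).trans (Fintype.card_prod _ _)
    have h2 : Fintype.card (Equiv.Perm (Fin (Fintype.card E))) =
        Fintype.card (Fin (Fintype.card E) ≃ E) :=
      Fintype.card_congr ((Equiv.refl _).equivCongr (Fintype.equivFin E).symm)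
    rw [h1, h2, Nat.cast_mul]
  have hθ : ∀ θ : Fin (Fintype.card E) ≃ E,
      p * (1 / (24 * α * (3 * α + 1)) * (κ * f S)) ≤
      ∑ c : Fin (Fintype.card E) → Bool × Fin m, ∑ σ : Fin (Fintype.card E) ≃ E,
        ∫ s, f ((A.output M lab (linearValue (elementWeight M f 0 c θ)) σ s).filter
          fun e => 0 < elementWeight M f 0 c θ e) ∂A.prob (Fintype.card E) := by
    intro θ
    -- The matroid is pulled back to the ranks, where the greedy analysis takes place.
    have hN : (M.comap θ).E = Set.univ := by simp [hM]
    have hind : ∀ S : Finset (Fin (Fintype.card E)),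
        M.Indep (S.map θ.toEmbedding : Finset E) ↔
          (M.comap θ).Indep (S : Set (Fin (Fintype.card E))) := by
      intro S
      rw [Matroid.comap_indep_iff, and_iff_left θ.injective.injOn, Finset.coe_map]
      rfl
    have hmap : (S.map θ.symm.toEmbedding).map θ.toEmbedding = S := by
      ext e
      simp
    have h1 := card_mul_le_sum_guarantee hN hind (isNonnegSubmodular_comp_map hf θ) (0 : Fin m)
      hα hm1 hm2 (O := S.map θ.symm.toEmbedding) ((hind _).1 (by rwa [hmap]))
    rw [hmap] at h1
    refine (mul_le_mul_of_nonneg_left h1 hp0.le).trans ?_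
    rw [Finset.mul_sum]
    exact Finset.sum_le_sum fun c _ => guarantee_le_sum_integral hf hA θ hN hind
  have hsum := Finset.sum_le_sum fun θ (_ : θ ∈ Finset.univ) => hθ θ
  simp only [Finset.sum_const, Finset.card_univ, nsmul_eq_mul] at hsum
  rw [← hp] at hsum
  have hinv : 1 / p * (κ * p)⁻¹ = 1 / (p * (κ * p)) := by
    rw [one_div, one_div, mul_inv p]
  rw [hcoins, ← mul_assoc (1 / p), hinv, one_div_mul_eq_div (p * (κ * p)),
    le_div_iff₀ (by positivity)]
  refine le_of_eq_of_le ?_ hsum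
  ring

end Instance

end SimulatedGreedy

theorem theorem1 :
    (∀ (Λ : Type w) (Linear : OnlineAlgorithm.{v, w} Λ), Linear.IsMSPAlgorithm.{u, v, w} →
      ∀ α : ℝ, 1 ≤ α →
        ∃ A : OnlineAlgorithm.{v, w} Λ, A.IsSMSPAlgorithm.{u, v, w} ∧
          ∀ (E : Type u) [Fintype E] (M : Matroid E) (lab : E → Λ), M.E = Set.univ →
            Linear.MSPCompetitive M lab α →
              A.SMSPCompetitive M lab (24 * α * (3 * α + 1))) ∧
    (fun α : ℝ => 24 * α * (3 * α + 1)) =O[𝓟 (Set.Ici 1)] (fun α : ℝ => α ^ 2) := by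
  refine ⟨fun Λ Linear hL α hα => ?_, ?_⟩
  -- The number of thinned classes is m = ⌈3α⌉, which satisfies 3α ≤ m < 3α + 1.
  · have : NeZero ⌈3 * α⌉₊ := ⟨(Nat.ceil_pos.2 (by linarith)).ne'⟩
    exact ⟨SimulatedGreedy.simulation Linear ⌈3 * α⌉₊,
      SimulatedGreedy.isSMSPAlgorithm_simulation Linear hL, fun E _ M lab hM hA =>
        SimulatedGreedy.sMSPCompetitive_simulation hM hα (Nat.le_ceil _)
          (Nat.ceil_lt_add_one (by linarith)) hA⟩
  -- The constant is 96 = 72 + 24, since 24α ≤ 24α² for α ≥ 1.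
  · refine IsBigO.of_bound 96 (eventually_principal.2 fun α (hα : 1 ≤ α) => ?_)
    rw [Real.norm_of_nonneg (by positivity), Real.norm_of_nonneg (by positivity)]
    nlinarith
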